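/- Let $n\ge 0$ and index the rows and columns of $2^n\times 2^n$ complex matrices by the computational basis $\{0,1\}^n$. Let $\mathcal C_n$ be the $n$-qubit Clifford group, i.e. the (finite) group of unitaries generated by the Hadamard gates and phase gates $S=\mathrm{diag}(1,i)$ on each qubit and the CNOT gates on each ordered pair of distinct qubits. For a set $\mathcal S\subseteq\mathcal C_n$ and a matrix $M\in\mathbb C^{2^n\times2^n}$ consider the problem $$\min\Big\{\|\mathbf x\|_1^2 \;:\; \mathbf x\in\mathbb C^{\mathcal S},\ M=\sum_{C\in\mathcal S}x_C\,C\Big\}.$$ The stabilizer extent $\xi(M)$ is this minimum for $\mathcal S=\mathcal C_n$, and a decomposition attaining it is called optimal. For a finite group $G$ of invertible real-linear maps of $\mathbb C^{2^n\times 2^n}$, let $\Pi_G(M)=\frac1{|G|}\sum_{\phi\in G}\phi(M)$, let $\mathcal C_n^G=\{C\in\mathcal C_n:\phi(C)=C\text{ for all }\phi\in G\}$, and let the $G$-symmetric stabilizer extent $\xi_G(M)$ be the minimum above for $\mathcal S=\mathcal C_n^G$. Let $\mathcal K_n=\{\mathrm{id},\,M\mapsto M^*\}$ (entrywise complex conjugation),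 let $\mathcal Z_n=\{M\mapsto Z(z)MZ(z)^\dagger : z\in\mathbb Z_2^n\}$ with $Z(z)=Z^{z_1}\otimes\dots\otimes Z^{z_n}$ and $Z=\mathrm{diag}(1,-1)$, and let $\mathcal K_n\times\mathcal Z_n$ be the group generated by these two commuting groups. The sets $\mathcal C_n^G$ for these three groups are the real, the diagonal, and the real diagonal Clifford unitaries, respectively. **Theorem.** Let $G\in\{\mathcal K_n,\ \mathcal Z_n,\ \mathcal K_n\times\mathcal Z_n\}$ and let $U\in\mathbb C^{2^n\times 2^n}$ satisfy $U=\Pi_G(U)$. Then both minima $\xi(U)$ and $\xi_G(U)$ exist, and $$\xi(U)=\xi_G(U).$$ In particular, $U$ has an optimal decomposition $U=\sum_{C\in\mathcal C_n}x_C\,C$ in which $x_C\neq0$ only for $C\in\mathcal C_n^G$. -/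

import Mathlib

/-- Complex `2^n × 2^n` matrices, with rows and columns indexed by the computational basis states
`|x⟩`, `x ∈ (ℤ/2)^n`. -/
abbrev QMat (n : ℕ) : Type := Matrix (Fin n → ZMod 2) (Fin n → ZMod 2) ℂ

/-! ### The Clifford group -/

/-- The one-qubit Hadamard gate. -/
noncomputable def hadamard : Matrix (ZMod 2) (ZMod 2) ℂ :=
  Matrix.of fun a b => (-1 : ℂ) ^ (a.val * b.val) / (Real.sqrt 2 : ℂ)

/-- The one-qubit phase gate `S = diag(1, i)`. -/
noncomputable def phaseS : Matrix (ZMod 2) (ZMod 2) ℂ :=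
  Matrix.diagonal fun a => Complex.I ^ a.val

/-- The one-qubit gate `A` acting on qubit `j`, and the identity on all other qubits. -/
def onQubit {n : ℕ} (j : Fin n) (A : Matrix (ZMod 2) (ZMod 2) ℂ) : QMat n :=
  Matrix.of fun x y => if ∀ k, k ≠ j → x k = y k then A (x j) (y j) else 0

/-- The controlled-NOT gate with control `j` and target `k`:
it maps `|y⟩` to `|y'⟩`, where `y'` is `y` with its `k`-th bit replaced by `y k + y j`. -/
def cnot {n : ℕ} (j k : Fin n) : QMat n :=
  Matrix.of fun x y => if x = Function.update y k (y k + y j) then 1 else 0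

/-- The `n`-qubit Clifford group: the group of unitaries generated by the Hadamard and phase gates
on every qubit and the controlled-NOT gates on every ordered pair of distinct qubits. -/
noncomputable def cliffordGroup (n : ℕ) : Subgroup (Matrix.unitaryGroup (Fin n → ZMod 2) ℂ) :=
  Subgroup.closure
    {U | (∃ j : Fin n, (U : QMat n) = onQubit j hadamard) ∨
      (∃ j : Fin n, (U : QMat n) = onQubit j phaseS) ∨
      (∃ j k : Fin n, j ≠ k ∧ (U : QMat n) = cnot j k)}

/-- The Clifford unitaries as a set of matrices. -/
def cliffords (n : ℕ) : Set (QMat n) :=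
  {C | ∃ U ∈ cliffordGroup n, (U : QMat n) = C}

/-! ### Symmetry groups

Linear and antilinear maps of complex matrices are in particular `ℝ`-linear, so a symmetry group is
a subgroup of the group of invertible `ℝ`-linear maps. -/

/-- Entrywise complex conjugation `M ↦ M^*`. -/
noncomputable def conjMap (n : ℕ) : QMat n ≃ₗ[ℝ] QMat n :=
  Complex.conjAe.toLinearEquiv.mapMatrix

/-- The group `K_n = {id, (·)^*}` generated by complex conjugation. -/
noncomputable def conjugationGroup (n : ℕ) : Subgroup (QMat n ≃ₗ[ℝ] QMat n) :=
  Subgroup.zpowers (conjMap n)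

/-- The diagonal Pauli operator `Z(z) = Z^{z_1} ⊗ ⋯ ⊗ Z^{z_n}`. -/
def pauliZ {n : ℕ} (z : Fin n → ZMod 2) : QMat n :=
  Matrix.diagonal fun x => ∏ j, (-1 : ℂ) ^ ((z j).val * (x j).val)

theorem pauliZ_zero {n : ℕ} : pauliZ (0 : Fin n → ZMod 2) = 1 := by
  simp [pauliZ]

theorem pauliZ_add {n : ℕ} (z w : Fin n → ZMod 2) : pauliZ (z + w) = pauliZ z * pauliZ w := by
  have h : ∀ a b c : ZMod 2, (-1 : ℂ) ^ ((a + b).val * c.val) =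
      (-1) ^ (a.val * c.val) * (-1) ^ (b.val * c.val) := by
    intro a b c
    rw [← pow_add, ← Nat.add_mul, neg_one_pow_eq_pow_mod_two, Nat.mul_mod, ZMod.val_add,
      Nat.mod_mod, ← Nat.mul_mod, ← neg_one_pow_eq_pow_mod_two]
  simp only [pauliZ, Matrix.diagonal_mul_diagonal, Pi.add_apply, h, Finset.prod_mul_distrib]

theorem pauliZ_mul_self {n : ℕ} (z : Fin n → ZMod 2) : pauliZ z * pauliZ z = 1 := by
  rw [← pauliZ_add, show z + z = 0 from funext fun j => CharTwo.add_self_eq_zero (z j), pauliZ_zero]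

theorem pauliZ_conjTranspose {n : ℕ} (z : Fin n → ZMod 2) :
    (pauliZ z).conjTranspose = pauliZ z := by
  rw [pauliZ, Matrix.diagonal_conjTranspose]
  congr 1
  funext x
  simp

/-- The channel `M ↦ Z(z) M Z(z)†`. -/
def pauliZChannel {n : ℕ} (z : Fin n → ZMod 2) : QMat n ≃ₗ[ℝ] QMat n where
  toFun M := pauliZ z * M * (pauliZ z).conjTranspose
  invFun M := pauliZ z * M * (pauliZ z).conjTranspose
  map_add' M N := by rw [Matrix.mul_add, Matrix.add_mul]
  map_smul' c M := by simp
  left_inv M := by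
    simp only [pauliZ_conjTranspose]
    rw [← Matrix.mul_assoc, ← Matrix.mul_assoc, pauliZ_mul_self, Matrix.one_mul, Matrix.mul_assoc,
      pauliZ_mul_self, Matrix.mul_one]
  right_inv M := by
    simp only [pauliZ_conjTranspose]
    rw [← Matrix.mul_assoc, ← Matrix.mul_assoc, pauliZ_mul_self, Matrix.one_mul, Matrix.mul_assoc,
      pauliZ_mul_self, Matrix.mul_one]

/-- The diagonal Pauli group `Z_n`, acting by the channels `M ↦ Z(z) M Z(z)†`. -/
def diagonalPauliGroup (n : ℕ) : Subgroup (QMat n ≃ₗ[ℝ] QMat n) where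
  carrier := Set.range pauliZChannel
  mul_mem' := by
    rintro _ _ ⟨z, rfl⟩ ⟨w, rfl⟩
    refine ⟨z + w, LinearEquiv.ext fun M => ?_⟩
    change pauliZ (z + w) * M * (pauliZ (z + w)).conjTranspose =
      pauliZ z * (pauliZ w * M * (pauliZ w).conjTranspose) * (pauliZ z).conjTranspose
    rw [pauliZ_add, Matrix.conjTranspose_mul]
    simp only [Matrix.mul_assoc]
  one_mem' := by
    refine ⟨0, LinearEquiv.ext fun M => ?_⟩
    change pauliZ 0 * M * (pauliZ 0).conjTranspose = M
    simp [pauliZ_zero]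
  inv_mem' := by
    rintro _ ⟨z, rfl⟩
    exact ⟨z, rfl⟩

/-- The group `K_n × Z_n` generated by the commuting groups `K_n` and `Z_n`. -/
noncomputable def conjugationDiagonalPauliGroup (n : ℕ) : Subgroup (QMat n ≃ₗ[ℝ] QMat n) :=
  conjugationGroup n ⊔ diagonalPauliGroup n

/-- The projection `Π_G(M) = |G|⁻¹ ∑_{φ ∈ G} φ(M)` onto the `G`-invariant subspace, for a finite
group `G`. -/
noncomputable def groupProjection {n : ℕ} (G : Subgroup (QMat n ≃ₗ[ℝ] QMat n)) (M : QMat n) :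
    QMat n :=
  (Nat.card G : ℝ)⁻¹ • ∑ᶠ φ : G, (φ : QMat n ≃ₗ[ℝ] QMat n) M

/-- The set `C_n^G` of `G`-invariant Clifford unitaries. -/
def invariantCliffords {n : ℕ} (G : Subgroup (QMat n ≃ₗ[ℝ] QMat n)) : Set (QMat n) :=
  {C | C ∈ cliffords n ∧ ∀ φ ∈ G, φ C = C}

/-! ### Extents -/

/-- `x` is a decomposition `M = ∑_{C ∈ S} x_C C`. -/
def IsDecomposition {n : ℕ} {S : Set (QMat n)} (x : S →₀ ℂ) (M : QMat n) : Prop :=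
  M = x.sum fun C c => c • (C : QMat n)

/-- The squared `ℓ₁`-norm of the coefficients of a decomposition. -/
noncomputable def decompositionCost {n : ℕ} {S : Set (QMat n)} (x : S →₀ ℂ) : ℝ :=
  (x.sum fun _ c => ‖c‖) ^ 2

/-- The values over which the extent of `M` with respect to `S` is the minimum. -/
def costSet {n : ℕ} (S : Set (QMat n)) (M : QMat n) : Set ℝ :=
  {r | ∃ x : S →₀ ℂ, IsDecomposition x M ∧ decompositionCost x = r}

/-- The stabilizer extent `ξ(M)`. -/
noncomputable def stabilizerExtent {n : ℕ} (M : QMat n) : ℝ :=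
  sInf (costSet (cliffords n) M)

/-- The `G`-symmetric stabilizer extent `ξ_G(M)`. -/
noncomputable def symmetricExtent {n : ℕ} (G : Subgroup (QMat n ≃ₗ[ℝ] QMat n)) (M : QMat n) : ℝ :=
  sInf (costSet (invariantCliffords G) M)

/-! It suffices that averaging over the symmetry group sends each `c • C`, with `C` Clifford, to a
combination of invariant Cliffords of `ℓ₁`-norm at most `‖c‖`. Applied termwise to any decomposition
of an invariant `U`, the average fixes `U` and does not raise the cost
(`HasBoundedDecomposition.map`).

Diagonal case (`zAverage_commutingCliffords`), one qubit at a time: write `C Z_k = Q C` with `Q`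
Pauli. Averaging over conjugation by `Z_k` gives `(1 + P) C / 2` with `P = Z_k Q`. If `Z_k` and `Q`
anticommute, then `P² = -1` and `(1 + P) / √2` is Clifford up to phase, so a single Clifford
suffices. If they commute, `P` is an involution. A Pauli `A` anticommuting with both `Z_k` and `Q`
(`exists_anticommuting_pauli`) then yields a Clifford `V`, namely `A` controlled on `P = -1`, with
`V Q = Z_k V` and `(1 + P) V = 1 + P`. The average is therefore the mean of `V C` and `P V C`, both
commuting with `Z_k`. All choices commute with the `Z_j` already treated, so the induction
continues.

Real case (`realAverage_commutingCliffords`): after a change of phase the conjugate of a Clifford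
`D` is `W D`, with `W` a real Weyl involution. If `R` is the square root of `W` with eigenvalues `1`
and `i`, then `R D` and `R W D` are real Cliffords, and the real part of `z D` combines them with
coefficients `(Re z ± Im z) / 2`, of `ℓ₁`-norm `max(|Re z|, |Im z|) ≤ |z|`. This step preserves
commutation with every `Z_j`, so it can follow the diagonal one and settles the joint symmetry.

Both arguments rest on `IsPauli.pauliRoot_mem`: square roots of Pauli involutions are Clifford. The
minima exist because the Cliffords form a finite spanning set. -/

/-! ### Signs and Weyl operators -/

/-- The nontrivial sign character of `ℤ/2`. -/
def zmodSign (t : ZMod 2) : ℂ := (-1) ^ t.val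

@[simp] theorem zmodSign_zero : zmodSign 0 = 1 := by simp [zmodSign]

@[simp] theorem zmodSign_one : zmodSign 1 = -1 := by simp [zmodSign, ZMod.val_one]

theorem ZMod.two_eq_zero_or_one (t : ZMod 2) : t = 0 ∨ t = 1 := by
  revert t; decide

theorem zmodSign_add (s t : ZMod 2) : zmodSign (s + t) = zmodSign s * zmodSign t := by
  rcases ZMod.two_eq_zero_or_one s with rfl | rfl <;>
    rcases ZMod.two_eq_zero_or_one t with rfl | rfl <;>
    simp [show (1 + 1 : ZMod 2) = 0 from rfl]

theorem zmodSign_mul_self (t : ZMod 2) : zmodSign t * zmodSign t = 1 := by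
  rcases ZMod.two_eq_zero_or_one t with rfl | rfl <;> simp

theorem zmodSign_ne_zero (t : ZMod 2) : zmodSign t ≠ 0 := by
  rcases ZMod.two_eq_zero_or_one t with rfl | rfl <;> simp

theorem zmodSign_sum {ι : Type*} (s : Finset ι) (f : ι → ZMod 2) :
    zmodSign (∑ i ∈ s, f i) = ∏ i ∈ s, zmodSign (f i) := by
  classical
  induction s using Finset.induction_on with
  | empty => simp
  | insert a s ha ih => rw [Finset.sum_insert ha, Finset.prod_insert ha, zmodSign_add, ih]

@[simp] theorem star_zmodSign (t : ZMod 2) : (starRingEnd ℂ) (zmodSign t) = zmodSign t := by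
  simp [zmodSign]

theorem zmodSign_eq_one {t : ZMod 2} (h : zmodSign t = 1) : t = 0 := by
  rcases ZMod.two_eq_zero_or_one t with rfl | rfl
  · rfl
  · rw [zmodSign_one] at h; norm_num at h

/-- The Weyl operator `X^a Z^b`. -/
def weyl {n : ℕ} (a b : Fin n → ZMod 2) : QMat n :=
  Matrix.of fun x y => if x = y + a then zmodSign (b ⬝ᵥ y) else 0

theorem pauliZ_eq_weyl {n : ℕ} (z : Fin n → ZMod 2) : pauliZ z = weyl 0 z := by
  ext x y
  simp only [pauliZ, weyl, Matrix.diagonal_apply, Matrix.of_apply, add_zero]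
  split_ifs with h
  · subst h
    rw [dotProduct, zmodSign_sum]
    refine Finset.prod_congr rfl fun j _ => ?_
    generalize z j = s, x j = t
    rcases ZMod.two_eq_zero_or_one s with rfl | rfl <;>
      rcases ZMod.two_eq_zero_or_one t with rfl | rfl <;> simp [ZMod.val_one]
  · rfl

@[simp] theorem weyl_zero {n : ℕ} : weyl (0 : Fin n → ZMod 2) 0 = 1 := by
  rw [← pauliZ_eq_weyl, pauliZ_zero]

theorem weyl_mul {n : ℕ} (a b c d : Fin n → ZMod 2) :
    weyl a b * weyl c d = zmodSign (b ⬝ᵥ c) • weyl (a + c) (b + d) := by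
  ext x y
  simp only [weyl, Matrix.mul_apply, Matrix.of_apply, Matrix.smul_apply, smul_eq_mul, mul_ite,
    mul_zero, Finset.sum_ite_eq', Finset.mem_univ, if_true]
  have : (x = y + c + a) ↔ (x = y + (a + c)) := by
    rw [add_assoc, add_comm c a]
  simp only [this, ite_mul, zero_mul]
  split_ifs
  · rw [← zmodSign_add, ← zmodSign_add, dotProduct_add, add_dotProduct]
    congr 1; ring
  · rfl

theorem weyl_map_star {n : ℕ} (a b : Fin n → ZMod 2) :
    (weyl a b).map (starRingEnd ℂ) = weyl a b := by
  ext x y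
  simp only [weyl, Matrix.map_apply, Matrix.of_apply]
  split_ifs <;> simp

theorem bits_add_self {n : ℕ} (a : Fin n → ZMod 2) : a + a = 0 :=
  funext fun k => CharTwo.add_self_eq_zero (a k)

theorem weyl_sq {n : ℕ} (a b : Fin n → ZMod 2) :
    weyl a b * weyl a b = zmodSign (b ⬝ᵥ a) • 1 := by
  rw [weyl_mul, bits_add_self, bits_add_self, weyl_zero]

theorem weyl_mul_comm {n : ℕ} (a b c d : Fin n → ZMod 2) :
    weyl a b * weyl c d = zmodSign (b ⬝ᵥ c + a ⬝ᵥ d) • (weyl c d * weyl a b) := by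
  rw [weyl_mul, weyl_mul, smul_smul, zmodSign_add, add_comm c a, add_comm d b, mul_assoc,
    dotProduct_comm d a, zmodSign_mul_self, mul_one]

/-! ### Tensor products of one-qubit gates -/

/-- The tensor product of a family of one-qubit operators. -/
def tensorMat {n : ℕ} (M : Fin n → Matrix (ZMod 2) (ZMod 2) ℂ) : QMat n :=
  Matrix.of fun x y => ∏ k, M k (x k) (y k)

theorem tensorMat_mul {n : ℕ} (M N : Fin n → Matrix (ZMod 2) (ZMod 2) ℂ) :
    tensorMat M * tensorMat N = tensorMat fun k => M k * N k := by
  ext x y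
  simp only [tensorMat, Matrix.mul_apply, Matrix.of_apply]
  rw [Finset.prod_univ_sum]
  simp [Finset.prod_mul_distrib]

theorem tensorMat_one {n : ℕ} : tensorMat (fun _ : Fin n => 1) = 1 := by
  ext x y
  simp only [tensorMat, Matrix.of_apply, Matrix.one_apply, Fintype.prod_ite_zero, funext_iff]
  simp

theorem tensorMat_update_smul {n : ℕ} (M : Fin n → Matrix (ZMod 2) (ZMod 2) ℂ) (j : Fin n) (c : ℂ)
    (A : Matrix (ZMod 2) (ZMod 2) ℂ) :
    tensorMat (Function.update M j (c • A)) = c • tensorMat (Function.update M j A) := by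
  ext x y
  simp only [tensorMat, Matrix.of_apply, Matrix.smul_apply, smul_eq_mul]
  rw [← Finset.mul_prod_erase _ _ (Finset.mem_univ j),
    ← Finset.mul_prod_erase _ (fun k => Function.update M j A k (x k) (y k)) (Finset.mem_univ j)]
  simp only [Function.update_self, Matrix.smul_apply, smul_eq_mul, mul_assoc]
  congr 2
  refine Finset.prod_congr rfl fun k hk => ?_
  rw [Function.update_of_ne (Finset.ne_of_mem_erase hk),
    Function.update_of_ne (Finset.ne_of_mem_erase hk)]

theorem onQubit_eq_tensorMat {n : ℕ} (j : Fin n) (A : Matrix (ZMod 2) (ZMod 2) ℂ) :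
    onQubit j A = tensorMat (Function.update (fun _ => 1) j A) := by
  ext x y
  simp only [tensorMat, onQubit, Matrix.of_apply]
  rw [← Finset.mul_prod_erase _ _ (Finset.mem_univ j), Function.update_self]
  have : ∏ k ∈ Finset.univ.erase j, Function.update
      (fun _ : Fin n => (1 : Matrix (ZMod 2) (ZMod 2) ℂ)) j A k (x k) (y k) =
      ∏ k ∈ Finset.univ.erase j, if x k = y k then (1 : ℂ) else 0 := by
    refine Finset.prod_congr rfl fun k hk => ?_
    rw [Function.update_of_ne (Finset.ne_of_mem_erase hk), Matrix.one_apply]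
  rw [this, Finset.prod_ite_zero]
  simp

theorem onQubit_mul_tensorMat {n : ℕ} (j : Fin n) (A : Matrix (ZMod 2) (ZMod 2) ℂ)
    (M : Fin n → Matrix (ZMod 2) (ZMod 2) ℂ) :
    onQubit j A * tensorMat M = tensorMat (Function.update M j (A * M j)) := by
  rw [onQubit_eq_tensorMat, tensorMat_mul]
  congr 1
  funext k
  by_cases h : k = j
  · subst h; simp
  · simp [h]

theorem tensorMat_mul_onQubit {n : ℕ} (j : Fin n) (A : Matrix (ZMod 2) (ZMod 2) ℂ)
    (M : Fin n → Matrix (ZMod 2) (ZMod 2) ℂ) :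
    tensorMat M * onQubit j A = tensorMat (Function.update M j (M j * A)) := by
  rw [onQubit_eq_tensorMat, tensorMat_mul]
  congr 1
  funext k
  by_cases h : k = j
  · subst h; simp
  · simp [h]

theorem onQubit_one {n : ℕ} (j : Fin n) : onQubit j 1 = 1 := by
  rw [onQubit_eq_tensorMat, Function.update_eq_self_iff.2 rfl, tensorMat_one]

theorem onQubit_mul {n : ℕ} (j : Fin n) (A B : Matrix (ZMod 2) (ZMod 2) ℂ) :
    onQubit j A * onQubit j B = onQubit j (A * B) := by
  rw [onQubit_eq_tensorMat j B, onQubit_mul_tensorMat, onQubit_eq_tensorMat]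
  simp

theorem onQubit_smul {n : ℕ} (j : Fin n) (c : ℂ) (A : Matrix (ZMod 2) (ZMod 2) ℂ) :
    onQubit j (c • A) = c • onQubit j A := by
  rw [onQubit_eq_tensorMat, tensorMat_update_smul, ← onQubit_eq_tensorMat]

theorem onQubit_conjTranspose {n : ℕ} (j : Fin n) (A : Matrix (ZMod 2) (ZMod 2) ℂ) :
    (onQubit j A).conjTranspose = onQubit j A.conjTranspose := by
  ext x y
  simp only [onQubit, Matrix.conjTranspose_apply, Matrix.of_apply, apply_ite star, star_zero,
    @eq_comm _ (x _) (y _)]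

theorem onQubit_map_star {n : ℕ} (j : Fin n) (A : Matrix (ZMod 2) (ZMod 2) ℂ) :
    (onQubit j A).map (starRingEnd ℂ) = onQubit j (A.map (starRingEnd ℂ)) := by
  ext x y
  simp only [onQubit, Matrix.map_apply, Matrix.of_apply]
  split_ifs <;> simp

/-- The one-qubit Weyl operator `X^a Z^b`. -/
def weylOne (a b : ZMod 2) : Matrix (ZMod 2) (ZMod 2) ℂ :=
  Matrix.of fun x y => if x = y + a then zmodSign (b * y) else 0

theorem weyl_eq_tensorMat {n : ℕ} (a b : Fin n → ZMod 2) :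
    weyl a b = tensorMat fun k => weylOne (a k) (b k) := by
  ext x y
  simp only [weyl, tensorMat, weylOne, Matrix.of_apply, Fintype.prod_ite_zero, funext_iff,
    Pi.add_apply, dotProduct, zmodSign_sum]
  congr

/-- A one-qubit intertwining relation of Weyl operators, on a qubit of a larger register. -/
theorem onQubit_mul_weyl {n : ℕ} (j : Fin n) {A : Matrix (ZMod 2) (ZMod 2) ℂ}
    {a b : Fin n → ZMod 2} {s t : ZMod 2} {c : ℂ}
    (h : A * weylOne (a j) (b j) = c • (weylOne s t * A)) :
    onQubit j A * weyl a b =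
      c • (weyl (Function.update a j s) (Function.update b j t) * onQubit j A) := by
  rw [weyl_eq_tensorMat, weyl_eq_tensorMat, onQubit_mul_tensorMat, tensorMat_mul_onQubit,
    ← tensorMat_update_smul, h]
  congr 1
  funext k
  by_cases hk : k = j
  · subst hk; simp
  · simp [hk]

theorem zmod_two_sum (f : ZMod 2 → ℂ) : ∑ t, f t = f 0 + f 1 := Fin.sum_univ_two f

theorem matrix_zmod_two_ext {A B : Matrix (ZMod 2) (ZMod 2) ℂ} (h00 : A 0 0 = B 0 0)
    (h01 : A 0 1 = B 0 1) (h10 : A 1 0 = B 1 0) (h11 : A 1 1 = B 1 1) : A = B := by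
  ext x y
  rcases ZMod.two_eq_zero_or_one x with rfl | rfl <;>
    rcases ZMod.two_eq_zero_or_one y with rfl | rfl <;> assumption

theorem sqrt_two_sq : (Real.sqrt 2 : ℂ) ^ 2 = 2 := by
  rw [← Complex.ofReal_pow, Real.sq_sqrt (by norm_num)]; norm_num

theorem sqrt_two_ne_zero : (Real.sqrt 2 : ℂ) ≠ 0 := by
  intro h
  have := sqrt_two_sq
  rw [h] at this; norm_num at this

theorem hadamard_mul_weylOne (a b : ZMod 2) :
    hadamard * weylOne a b = zmodSign (a * b) • (weylOne b a * hadamard) := by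
  rcases ZMod.two_eq_zero_or_one a with rfl | rfl <;>
    rcases ZMod.two_eq_zero_or_one b with rfl | rfl <;>
    apply matrix_zmod_two_ext <;>
    simp [hadamard, weylOne, Matrix.mul_apply, zmod_two_sum, ZMod.val_one,
      show (1 + 1 : ZMod 2) = 0 from rfl] <;>
    ring

theorem phaseS_mul_weylOne (a b : ZMod 2) :
    phaseS * weylOne a b = Complex.I ^ a.val • (weylOne a (b + a) * phaseS) := by
  rcases ZMod.two_eq_zero_or_one a with rfl | rfl <;>
    rcases ZMod.two_eq_zero_or_one b with rfl | rfl <;>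
    apply matrix_zmod_two_ext <;>
    simp [phaseS, weylOne, Matrix.mul_apply, ZMod.val_one, Matrix.diagonal_apply,
      show (1 + 1 : ZMod 2) = 0 from rfl]

theorem hadamard_mul_self : hadamard * hadamard = 1 := by
  apply matrix_zmod_two_ext <;>
    simp [hadamard, Matrix.mul_apply, zmod_two_sum, ZMod.val_one] <;>
    field_simp [sqrt_two_ne_zero] <;> rw [sqrt_two_sq] <;> norm_num

theorem hadamard_conjTranspose : hadamard.conjTranspose = hadamard := by
  apply matrix_zmod_two_ext <;> simp [hadamard, ZMod.val_one]

theorem hadamard_map_star : hadamard.map (starRingEnd ℂ) = hadamard := by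
  apply matrix_zmod_two_ext <;> simp [hadamard, ZMod.val_one]

theorem phaseS_mul_conjTranspose : phaseS * phaseS.conjTranspose = 1 := by
  apply matrix_zmod_two_ext <;>
    simp [phaseS, Matrix.mul_apply, ZMod.val_one, Matrix.diagonal_apply]

theorem phaseS_pow_four : phaseS * phaseS * phaseS * phaseS = 1 := by
  apply matrix_zmod_two_ext <;>
    simp [phaseS, Matrix.mul_apply, ZMod.val_one, Matrix.diagonal_apply]

theorem phaseS_map_star : phaseS.map (starRingEnd ℂ) = weylOne 0 1 * phaseS := by
  apply matrix_zmod_two_ext <;>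
    simp [phaseS, weylOne, Matrix.mul_apply, ZMod.val_one, Matrix.diagonal_apply]

/-- The primitive eighth root of unity `(1 + i) / √2`. -/
noncomputable def omegaEight : ℂ := (1 + Complex.I) / (Real.sqrt 2 : ℂ)

theorem omegaEight_sq : omegaEight ^ 2 = Complex.I := by
  rw [omegaEight, div_pow, sqrt_two_sq]
  linear_combination (1 / 2 : ℂ) * Complex.I_sq

/-- This relation is the source of the scalar phases in the Clifford group as soon as there is at
least one qubit. -/
theorem hadamard_phaseS_cube :
    hadamard * phaseS * (hadamard * phaseS) * (hadamard * phaseS) = omegaEight • 1 := by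
  have h2 := sqrt_two_sq
  have hI := Complex.I_sq
  have h0 := sqrt_two_ne_zero
  apply matrix_zmod_two_ext <;>
    simp [hadamard, phaseS, omegaEight, Matrix.mul_apply, zmod_two_sum, ZMod.val_one,
      Matrix.diagonal_apply] <;> field_simp <;> grind

/-! ### The controlled-NOT gate -/

theorem update_add_eq_single {n : ℕ} (j k : Fin n) (y : Fin n → ZMod 2) :
    Function.update y k (y k + y j) = y + Pi.single k (y j) := by
  funext l
  by_cases h : l = k
  · subst h; simp
  · simp [h]

theorem cnot_apply {n : ℕ} (j k : Fin n) (x y : Fin n → ZMod 2) :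
    cnot j k x y = if x = y + Pi.single k (y j) then 1 else 0 := by
  simp only [cnot, Matrix.of_apply, update_add_eq_single]

theorem eq_add_single_comm {n : ℕ} {j k : Fin n} (h : j ≠ k) (x y : Fin n → ZMod 2) :
    x = y + Pi.single k (y j) ↔ y = x + Pi.single k (x j) := by
  have key : ∀ x y : Fin n → ZMod 2, x = y + Pi.single k (y j) → y = x + Pi.single k (x j) := by
    rintro _ y rfl
    simp [Pi.add_apply, Pi.single_eq_of_ne h, add_assoc, bits_add_self]
  exact ⟨key x y, key y x⟩

theorem cnot_conjTranspose {n : ℕ} {j k : Fin n} (h : j ≠ k) :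
    (cnot j k).conjTranspose = cnot j k := by
  ext x y
  simp only [Matrix.conjTranspose_apply, cnot_apply, eq_add_single_comm h y x, apply_ite star,
    star_one, star_zero]

theorem cnot_map_star {n : ℕ} (j k : Fin n) :
    (cnot j k).map (starRingEnd ℂ) = cnot j k := by
  ext x y
  simp only [Matrix.map_apply, cnot_apply]
  split_ifs <;> simp

theorem cnot_mul_apply {n : ℕ} {j k : Fin n} (h : j ≠ k) (M : QMat n) (x y : Fin n → ZMod 2) :
    (cnot j k * M) x y = M (x + Pi.single k (x j)) y := by
  simp [Matrix.mul_apply, cnot_apply, eq_add_single_comm h x]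

theorem mul_cnot_apply {n : ℕ} (j k : Fin n) (M : QMat n) (x y : Fin n → ZMod 2) :
    (M * cnot j k) x y = M x (y + Pi.single k (y j)) := by
  simp [Matrix.mul_apply, cnot_apply]

theorem cnot_mul_self {n : ℕ} {j k : Fin n} (h : j ≠ k) : cnot j k * cnot j k = 1 := by
  ext x y
  rw [cnot_mul_apply h, cnot_apply, Matrix.one_apply]
  refine if_congr ?_ rfl rfl
  rw [eq_add_single_comm h]
  simp [Pi.single_eq_of_ne h, add_assoc, bits_add_self, @eq_comm _ y x]

theorem cnot_mul_weyl {n : ℕ} {j k : Fin n} (h : j ≠ k) (a b : Fin n → ZMod 2) :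
    cnot j k * weyl a b =
      weyl (a + Pi.single k (a j)) (b + Pi.single j (b k)) * cnot j k := by
  ext x y
  rw [cnot_mul_apply h, mul_cnot_apply]
  simp only [weyl, Matrix.of_apply]
  refine if_congr ?_ ?_ rfl
  · rw [eq_comm, ← eq_add_single_comm h x (y + a), Pi.add_apply, Pi.single_add,
      show y + a + (Pi.single k (y j) + Pi.single k (a j)) =
        y + Pi.single k (y j) + (a + Pi.single k (a j)) by abel]
  · congr 1
    simp only [add_dotProduct, dotProduct_add, single_dotProduct, dotProduct_single,
      Pi.add_apply, Pi.single_eq_of_ne h.symm]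
    linear_combination -CharTwo.add_self_eq_zero (b k * y j)

/-! ### Closure properties of the Clifford group -/

theorem one_mem_cliffords (n : ℕ) : (1 : QMat n) ∈ cliffords n :=
  ⟨1, one_mem _, rfl⟩

theorem mul_mem_cliffords {n : ℕ} {C D : QMat n} (hC : C ∈ cliffords n) (hD : D ∈ cliffords n) :
    C * D ∈ cliffords n := by
  obtain ⟨U, hU, rfl⟩ := hC
  obtain ⟨V, hV, rfl⟩ := hD
  exact ⟨U * V, mul_mem hU hV, rfl⟩

theorem conjTranspose_mem_cliffords {n : ℕ} {C : QMat n} (hC : C ∈ cliffords n) :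
    C.conjTranspose ∈ cliffords n := by
  obtain ⟨U, hU, rfl⟩ := hC
  exact ⟨U⁻¹, inv_mem hU, rfl⟩

theorem cliffords_mul_conjTranspose {n : ℕ} {C : QMat n} (hC : C ∈ cliffords n) :
    C * C.conjTranspose = 1 := by
  obtain ⟨U, -, rfl⟩ := hC
  exact Matrix.mem_unitaryGroup_iff.1 U.2

theorem cliffords_conjTranspose_mul {n : ℕ} {C : QMat n} (hC : C ∈ cliffords n) :
    C.conjTranspose * C = 1 := by
  obtain ⟨U, -, rfl⟩ := hC
  exact Matrix.mem_unitaryGroup_iff'.1 U.2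

theorem hadamard_mem_cliffords {n : ℕ} (j : Fin n) : onQubit j hadamard ∈ cliffords n := by
  have h : onQubit j hadamard ∈ Matrix.unitaryGroup (Fin n → ZMod 2) ℂ := by
    rw [Matrix.mem_unitaryGroup_iff, Matrix.star_eq_conjTranspose, onQubit_conjTranspose,
      onQubit_mul, hadamard_conjTranspose, hadamard_mul_self, onQubit_one]
  exact ⟨⟨_, h⟩, Subgroup.subset_closure (Or.inl ⟨j, rfl⟩), rfl⟩

theorem phaseS_mem_cliffords {n : ℕ} (j : Fin n) : onQubit j phaseS ∈ cliffords n := by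
  have h : onQubit j phaseS ∈ Matrix.unitaryGroup (Fin n → ZMod 2) ℂ := by
    rw [Matrix.mem_unitaryGroup_iff, Matrix.star_eq_conjTranspose, onQubit_conjTranspose,
      onQubit_mul, phaseS_mul_conjTranspose, onQubit_one]
  exact ⟨⟨_, h⟩, Subgroup.subset_closure (Or.inr (Or.inl ⟨j, rfl⟩)), rfl⟩

theorem cnot_mem_cliffords {n : ℕ} {j k : Fin n} (hjk : j ≠ k) : cnot j k ∈ cliffords n := by
  have h : cnot j k ∈ Matrix.unitaryGroup (Fin n → ZMod 2) ℂ := by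
    rw [Matrix.mem_unitaryGroup_iff, Matrix.star_eq_conjTranspose, cnot_conjTranspose hjk,
      cnot_mul_self hjk]
  exact ⟨⟨_, h⟩, Subgroup.subset_closure (Or.inr (Or.inr ⟨j, k, hjk, rfl⟩)), rfl⟩

/-- Every Clifford unitary is a product of Hadamard, phase and controlled-NOT gates. -/
theorem cliffords_induction {n : ℕ} {p : QMat n → Prop} (one : p 1)
    (had : ∀ j C, p C → p (onQubit j hadamard * C))
    (phase : ∀ j C, p C → p (onQubit j phaseS * C))
    (cx : ∀ j k, j ≠ k → ∀ C, p C → p (cnot j k * C)) {C : QMat n} (hC : C ∈ cliffords n) :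
    p C := by
  obtain ⟨U, hU, rfl⟩ := hC
  have gate : ∀ V : Matrix.unitaryGroup (Fin n → ZMod 2) ℂ,
      ((∃ j : Fin n, (V : QMat n) = onQubit j hadamard) ∨
      (∃ j : Fin n, (V : QMat n) = onQubit j phaseS) ∨
      (∃ j k : Fin n, j ≠ k ∧ (V : QMat n) = cnot j k)) →
      (∀ C, p C → p (V * C)) ∧ V * V * V * V = 1 := by
    rintro V (⟨j, hV⟩ | ⟨j, hV⟩ | ⟨j, k, hjk, hV⟩)
    · refine ⟨hV ▸ had j, Subtype.ext ?_⟩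
      simp only [Matrix.UnitaryGroup.mul_val, Matrix.UnitaryGroup.one_val, hV, onQubit_mul,
        hadamard_mul_self, one_mul, onQubit_one]
    · refine ⟨hV ▸ phase j, Subtype.ext ?_⟩
      simp only [Matrix.UnitaryGroup.mul_val, Matrix.UnitaryGroup.one_val, hV, onQubit_mul,
        phaseS_pow_four, onQubit_one]
    · refine ⟨hV ▸ cx j k hjk, Subtype.ext ?_⟩
      simp only [Matrix.UnitaryGroup.mul_val, Matrix.UnitaryGroup.one_val, hV,
        cnot_mul_self hjk, one_mul]
  induction hU using Subgroup.closure_induction_left with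
  | one => exact one
  | mul_left V hV W _ ih => exact (gate V hV).1 _ ih
  | inv_mul_cancel V hV W _ ih =>
    -- Every generator has order dividing four, so its inverse is its cube and needs no separate
    -- case.
    obtain ⟨h, h4⟩ := gate V hV
    have : V⁻¹ * W = V * (V * (V * W)) := by
      rw [inv_mul_eq_iff_eq_mul]
      simp only [← mul_assoc, h4, one_mul]
    rw [this]
    exact h _ (h _ (h _ ih))

theorem cliffords_zero {C : QMat 0} (hC : C ∈ cliffords 0) : C = 1 :=
  cliffords_induction (p := fun C => C = 1) rfl (fun j => j.elim0) (fun j => j.elim0)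
    (fun j => j.elim0) hC

theorem omegaEight_mem_cliffords {n : ℕ} (j : Fin n) :
    omegaEight • (1 : QMat n) ∈ cliffords n := by
  have h := mul_mem_cliffords (hadamard_mem_cliffords j) (phaseS_mem_cliffords j)
  have h3 := mul_mem_cliffords (mul_mem_cliffords h h) h
  rwa [onQubit_mul, onQubit_mul, onQubit_mul, hadamard_phaseS_cube, onQubit_smul,
    onQubit_one] at h3

theorem smul_mem_cliffords {n : ℕ} {c : ℂ} {C : QMat n} (hc : c • (1 : QMat n) ∈ cliffords n)
    (hC : C ∈ cliffords n) : c • C ∈ cliffords n := by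
  simpa using mul_mem_cliffords hc hC

/-- The fourth power of every generating gate is the identity. This bounds the scalars in the
finiteness proof. -/
theorem cliffords_det_pow {n : ℕ} {C : QMat n} (hC : C ∈ cliffords n) : C.det ^ 4 = 1 := by
  have gate : ∀ g : QMat n, g * g * g * g = 1 → ∀ C : QMat n, C.det ^ 4 = 1 →
      (g * C).det ^ 4 = 1 := by
    intro g hg C hC
    rw [Matrix.det_mul, mul_pow, hC, mul_one, ← Matrix.det_pow]
    rw [show g ^ 4 = g * g * g * g by noncomm_ring, hg, Matrix.det_one]
  refine cliffords_induction (p := fun C => C.det ^ 4 = 1) (by simp) (fun j => gate _ ?_)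
    (fun j => gate _ ?_) (fun j k hjk => gate _ ?_) hC
  · simp only [onQubit_mul, hadamard_mul_self, one_mul, onQubit_one]
  · simp only [onQubit_mul, phaseS_pow_four, onQubit_one]
  · simp only [cnot_mul_self hjk, one_mul]

/-! ### Pauli operators -/

/-- Pauli operators: Weyl operators up to a fourth root of unity. -/
def IsPauli {n : ℕ} (P : QMat n) : Prop :=
  ∃ (c : ℂ) (a b : Fin n → ZMod 2), c ^ 4 = 1 ∧ P = c • weyl a b

theorem isPauli_weyl {n : ℕ} (a b : Fin n → ZMod 2) : IsPauli (weyl a b) :=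
  ⟨1, a, b, by simp, by simp⟩

theorem isPauli_one {n : ℕ} : IsPauli (1 : QMat n) := by
  rw [← weyl_zero]; exact isPauli_weyl 0 0

theorem zmodSign_pow_four (t : ZMod 2) : zmodSign t ^ 4 = 1 := by
  linear_combination (zmodSign t * zmodSign t + 1) * zmodSign_mul_self t

theorem IsPauli.smul {n : ℕ} {c : ℂ} (hc : c ^ 4 = 1) {P : QMat n} (hP : IsPauli P) :
    IsPauli (c • P) := by
  obtain ⟨d, a, b, hd, rfl⟩ := hP
  exact ⟨c * d, a, b, by rw [mul_pow, hc, hd, one_mul], smul_smul _ _ _⟩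

theorem IsPauli.mul {n : ℕ} {P Q : QMat n} (hP : IsPauli P) (hQ : IsPauli Q) :
    IsPauli (P * Q) := by
  obtain ⟨c, a, b, hc, rfl⟩ := hP
  obtain ⟨d, a', b', hd, rfl⟩ := hQ
  rw [smul_mul_smul_comm, weyl_mul]
  exact ((isPauli_weyl _ _).smul (zmodSign_pow_four _)).smul (by rw [mul_pow, hc, hd, one_mul])

/-- Two Pauli operators commute or anticommute. -/
theorem IsPauli.mul_eq_or {n : ℕ} {P Q : QMat n} (hP : IsPauli P) (hQ : IsPauli Q) :
    P * Q = Q * P ∨ P * Q = -(Q * P) := by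
  obtain ⟨c, a, b, -, rfl⟩ := hP
  obtain ⟨d, a', b', -, rfl⟩ := hQ
  rw [smul_mul_smul_comm, smul_mul_smul_comm, weyl_mul_comm a b, mul_comm d c]
  rcases ZMod.two_eq_zero_or_one (b ⬝ᵥ a' + a ⬝ᵥ b') with h | h
  · left; rw [h, zmodSign_zero, one_smul]
  · right; rw [h, zmodSign_one, neg_one_smul, smul_neg]

theorem hadamard_mul_weyl {n : ℕ} (j : Fin n) (a b : Fin n → ZMod 2) :
    onQubit j hadamard * weyl a b = zmodSign (a j * b j) •
      (weyl (Function.update a j (b j)) (Function.update b j (a j)) * onQubit j hadamard) :=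
  onQubit_mul_weyl j (hadamard_mul_weylOne _ _)

theorem phaseS_mul_weyl {n : ℕ} (j : Fin n) (a b : Fin n → ZMod 2) :
    onQubit j phaseS * weyl a b = Complex.I ^ (a j).val •
      (weyl a (Function.update b j (b j + a j)) * onQubit j phaseS) := by
  have := onQubit_mul_weyl j (phaseS_mul_weylOne (a j) (b j))
  rwa [Function.update_eq_self] at this

theorem I_pow_pow_four (k : ℕ) : (Complex.I ^ k) ^ 4 = 1 := by
  rw [pow_right_comm, Complex.I_pow_four, one_pow]

theorem mul_isPauli_of_mul_weyl {n : ℕ} {g : QMat n}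
    (h : ∀ a b, ∃ (d : ℂ) (a' b' : Fin n → ZMod 2), d ^ 4 = 1 ∧
      g * weyl a b = d • (weyl a' b' * g)) (P : QMat n) (hP : IsPauli P) :
    ∃ Q, IsPauli Q ∧ g * P = Q * g := by
  obtain ⟨c, a, b, hc, rfl⟩ := hP
  obtain ⟨d, a', b', hd, h⟩ := h a b
  refine ⟨c • d • weyl a' b', ((isPauli_weyl a' b').smul hd).smul hc, ?_⟩
  rw [mul_smul_comm, h, smul_mul_assoc, smul_mul_assoc]

theorem hadamard_mul_isPauli {n : ℕ} (j : Fin n) (P : QMat n) (hP : IsPauli P) :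
    ∃ Q, IsPauli Q ∧ onQubit j hadamard * P = Q * onQubit j hadamard :=
  mul_isPauli_of_mul_weyl (fun a b => ⟨_, _, _, zmodSign_pow_four _, hadamard_mul_weyl j a b⟩) P hP

theorem phaseS_mul_isPauli {n : ℕ} (j : Fin n) (P : QMat n) (hP : IsPauli P) :
    ∃ Q, IsPauli Q ∧ onQubit j phaseS * P = Q * onQubit j phaseS :=
  mul_isPauli_of_mul_weyl (fun a b => ⟨_, _, _, I_pow_pow_four _, phaseS_mul_weyl j a b⟩) P hP

theorem cnot_mul_isPauli {n : ℕ} {j k : Fin n} (hjk : j ≠ k) (P : QMat n) (hP : IsPauli P) :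
    ∃ Q, IsPauli Q ∧ cnot j k * P = Q * cnot j k :=
  mul_isPauli_of_mul_weyl
    (fun a b => ⟨1, _, _, one_pow 4, by rw [cnot_mul_weyl hjk, one_smul]⟩) P hP

/-- Clifford unitaries normalize the Pauli group. -/
theorem cliffords_mul_isPauli {n : ℕ} {C : QMat n} (hC : C ∈ cliffords n) (P : QMat n)
    (hP : IsPauli P) : ∃ Q, IsPauli Q ∧ C * P = Q * C := by
  have step : ∀ g : QMat n, (∀ P : QMat n, IsPauli P → ∃ Q, IsPauli Q ∧ g * P = Q * g) →
      ∀ C, (∀ P : QMat n, IsPauli P → ∃ Q, IsPauli Q ∧ C * P = Q * C) →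
      ∀ P : QMat n, IsPauli P → ∃ Q, IsPauli Q ∧ g * C * P = Q * (g * C) := by
    intro g hg C hC P hP
    obtain ⟨Q, hQ, h⟩ := hC P hP
    obtain ⟨R, hR, h'⟩ := hg Q hQ
    exact ⟨R, hR, by rw [mul_assoc, h, ← mul_assoc, h', mul_assoc]⟩
  exact cliffords_induction
    (p := fun C => ∀ P : QMat n, IsPauli P → ∃ Q, IsPauli Q ∧ C * P = Q * C)
    (fun P hP => ⟨P, hP, by simp⟩)
    (fun j => step _ (hadamard_mul_isPauli j)) (fun j => step _ (phaseS_mul_isPauli j))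
    (fun j k hjk => step _ (cnot_mul_isPauli hjk)) hC P hP

theorem weyl_single_eq_onQubit {n : ℕ} (j : Fin n) :
    weyl 0 (Pi.single j 1) = onQubit j (weylOne 0 1) := by
  rw [onQubit_eq_tensorMat, weyl_eq_tensorMat]
  congr 1
  funext k
  by_cases hk : k = j
  · subst hk; simp
  · simp only [Function.update_of_ne hk, Pi.zero_apply, Pi.single_eq_of_ne hk]
    ext x y
    simp [weylOne, Matrix.one_apply]

/-- The complex conjugate of a Clifford unitary differs from it by a Pauli operator. -/
theorem cliffords_map_star {n : ℕ} {C : QMat n} (hC : C ∈ cliffords n) :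
    ∃ P, IsPauli P ∧ C.map (starRingEnd ℂ) = P * C := by
  have step : ∀ g : QMat n, (∀ P : QMat n, IsPauli P → ∃ Q, IsPauli Q ∧ g * P = Q * g) →
      (∃ P, IsPauli P ∧ g.map (starRingEnd ℂ) = P * g) →
      ∀ C : QMat n, (∃ P, IsPauli P ∧ C.map (starRingEnd ℂ) = P * C) →
      ∃ P, IsPauli P ∧ (g * C).map (starRingEnd ℂ) = P * (g * C) := by
    rintro g hg ⟨P, hP, hPg⟩ C ⟨Q, hQ, hQC⟩
    obtain ⟨R, hR, hgR⟩ := hg Q hQ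
    -- The conjugate of `g C` is `P g Q C`, and moving `Q` through `g` turns it into `R`.
    refine ⟨P * R, hP.mul hR, ?_⟩
    rw [Matrix.map_mul, hPg, hQC, mul_assoc, ← mul_assoc g, hgR]
    simp only [mul_assoc]
  refine cliffords_induction (p := fun C => ∃ P, IsPauli P ∧ C.map (starRingEnd ℂ) = P * C)
    ⟨1, isPauli_one, ?_⟩
    (fun j => step _ (hadamard_mul_isPauli j) ⟨1, isPauli_one, ?_⟩)
    (fun j => step _ (phaseS_mul_isPauli j)
      ⟨weyl 0 (Pi.single j 1), isPauli_weyl _ _, ?_⟩)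
    (fun j k hjk => step _ (cnot_mul_isPauli hjk) ⟨1, isPauli_one, ?_⟩) hC
  · rw [Matrix.map_one _ (map_zero _) (map_one _), one_mul]
  · rw [onQubit_map_star, hadamard_map_star, one_mul]
  · rw [onQubit_map_star, phaseS_map_star, ← onQubit_mul, weyl_single_eq_onQubit]
  · rw [cnot_map_star, one_mul]

/-! ### Square roots of Pauli operators -/

/-- For an involution `P`, the square root of `P` with eigenvalues `1` and `i`. -/
noncomputable def pauliRoot {n : ℕ} (P : QMat n) : QMat n :=
  ((1 + Complex.I) / 2) • 1 + ((1 - Complex.I) / 2) • P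

theorem pauliRoot_mul_self {n : ℕ} {P : QMat n} (h : P * P = 1) :
    pauliRoot P * pauliRoot P = P := by
  simp only [pauliRoot, add_mul, mul_add, smul_mul_smul_comm, mul_one, one_mul, h]
  have hI := Complex.I_sq
  match_scalars <;> grind

theorem pauliRoot_mul {n : ℕ} {P : QMat n} (h : P * P = 1) :
    pauliRoot P * P = ((1 - Complex.I) / 2) • 1 + ((1 + Complex.I) / 2) • P := by
  simp only [pauliRoot, add_mul, smul_mul_assoc, one_mul, h]
  exact add_comm _ _

theorem pauliRoot_neg {n : ℕ} {P : QMat n} (h : P * P = 1) :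
    pauliRoot (-P) = Complex.I • (pauliRoot P * P) := by
  rw [pauliRoot_mul h, pauliRoot]
  have hI := Complex.I_sq
  match_scalars <;> grind

/-- The root is an affine function of the involution, hence compatible with unitary conjugation. -/
theorem pauliRoot_conj {n : ℕ} {g P Q : QMat n} (hg : g.conjTranspose * g = 1)
    (h : g * P = Q * g) : pauliRoot P = g.conjTranspose * pauliRoot Q * g := by
  have hP : P = g.conjTranspose * Q * g := by
    rw [mul_assoc, ← h, ← mul_assoc, hg, one_mul]
  simp only [pauliRoot, mul_add, add_mul, mul_smul_comm, smul_mul_assoc, mul_one, hg, ← hP]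

theorem I_smul_one_mem_cliffords {n : ℕ} (j : Fin n) :
    Complex.I • (1 : QMat n) ∈ cliffords n := by
  rw [← omegaEight_sq, pow_two, ← smul_smul]
  exact smul_mem_cliffords (omegaEight_mem_cliffords j) (omegaEight_mem_cliffords j)

theorem pauliRoot_neg_mem {n : ℕ} (j : Fin n) {P : QMat n} (h : P * P = 1)
    (hP : pauliRoot P ∈ cliffords n) : pauliRoot (-P) ∈ cliffords n := by
  rw [pauliRoot_neg h]
  refine smul_mem_cliffords (I_smul_one_mem_cliffords j) (mul_mem_cliffords hP ?_)
  rw [← pauliRoot_mul_self h]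
  exact mul_mem_cliffords hP hP

/-- All square roots of involutions proportional to `X^a Z^b` are Clifford unitaries. -/
def HasCliffordRoot {n : ℕ} (a b : Fin n → ZMod 2) : Prop :=
  ∀ c : ℂ, (c • weyl a b) * (c • weyl a b) = 1 → pauliRoot (c • weyl a b) ∈ cliffords n

/-- Conjugating by a Clifford carries roots to roots. The phase `d` is harmless because
`HasCliffordRoot` quantifies over all scalars making the operator an involution. -/
theorem HasCliffordRoot.of_conj {n : ℕ} {g : QMat n} (hg : g ∈ cliffords n)
    {a b a' b' : Fin n → ZMod 2} {d : ℂ} (h : g * weyl a b = d • (weyl a' b' * g))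
    (H : HasCliffordRoot a' b') : HasCliffordRoot a b := by
  intro c hc
  have hgP : g * (c • weyl a b) = ((c * d) • weyl a' b') * g := by
    rw [mul_smul_comm, h, smul_mul_assoc, smul_smul]
  have hQ : (c * d) • weyl a' b' = g * (c • weyl a b) * g.conjTranspose := by
    rw [hgP, mul_assoc, cliffords_mul_conjTranspose hg, mul_one]
  have hsq : ((c * d) • weyl a' b') * ((c * d) • weyl a' b') = 1 := by
    calc _ = (c * d) • weyl a' b' * (g * (c • weyl a b) * g.conjTranspose) := by rw [← hQ]
      _ = ((c * d) • weyl a' b' * g) * (c • weyl a b) * g.conjTranspose := by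
        simp only [mul_assoc]
      _ = g * ((c • weyl a b) * (c • weyl a b)) * g.conjTranspose := by
        rw [← hgP]; simp only [mul_assoc]
      _ = 1 := by rw [hc, mul_one, cliffords_mul_conjTranspose hg]
  rw [pauliRoot_conj (cliffords_conjTranspose_mul hg) hgP]
  exact mul_mem_cliffords (mul_mem_cliffords (conjTranspose_mem_cliffords hg) (H _ hsq)) hg

theorem pauliRoot_weyl_single {n : ℕ} (j : Fin n) :
    pauliRoot (weyl 0 (Pi.single j 1)) = onQubit j phaseS := by
  have h : phaseS = ((1 + Complex.I) / 2) • 1 + ((1 - Complex.I) / 2) • weylOne 0 1 := by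
    apply matrix_zmod_two_ext <;> simp [phaseS, weylOne, ZMod.val_one] <;> ring
  have hadd : ∀ A B, onQubit j (A + B) = onQubit j A + onQubit j B := by
    intro A B
    ext x y
    simp only [onQubit, Matrix.of_apply, Matrix.add_apply]
    split_ifs <;> simp
  rw [h, hadd, onQubit_smul, onQubit_smul, onQubit_one, weyl_single_eq_onQubit, pauliRoot]

/-- Here only the scalars `±1` give involutions, and the root of `-P` is `i` times the inverse of
the root of `P`. The qubit `j` is what makes the phase `i` available. -/
theorem hasCliffordRoot_of_mem {n : ℕ} (j : Fin n) {a b : Fin n → ZMod 2}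
    (h : weyl a b * weyl a b = 1) (hab : pauliRoot (weyl a b) ∈ cliffords n) :
    HasCliffordRoot a b := by
  intro c hc
  have hc1 : c * c = 1 := by
    rw [smul_mul_smul_comm, h] at hc
    simpa using congrFun (congrFun hc 0) 0
  rcases mul_self_eq_one_iff.1 hc1 with rfl | rfl
  · rwa [one_smul]
  · rw [neg_one_smul]
    exact pauliRoot_neg_mem j h hab

theorem hasCliffordRoot_zero {n : ℕ} (j : Fin n) : HasCliffordRoot (0 : Fin n → ZMod 2) 0 := by
  refine hasCliffordRoot_of_mem j (by simp) ?_
  have : pauliRoot (weyl (0 : Fin n → ZMod 2) 0) = 1 := by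
    rw [weyl_zero, pauliRoot, ← add_smul]
    convert one_smul ℂ _ using 2
    ring
  rw [this]
  exact one_mem_cliffords n

theorem hasCliffordRoot_single {n : ℕ} (j : Fin n) :
    HasCliffordRoot (0 : Fin n → ZMod 2) (Pi.single j 1) := by
  refine hasCliffordRoot_of_mem j (by simp [weyl_sq]) ?_
  rw [pauliRoot_weyl_single]
  exact phaseS_mem_cliffords j

/-- A nontrivial tensor factor can be rotated to `Z`. -/
theorem HasCliffordRoot.of_update {n : ℕ} {a b : Fin n → ZMod 2} {j : Fin n}
    (hj : a j ≠ 0 ∨ b j ≠ 0)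
    (H : HasCliffordRoot (Function.update a j 0) (Function.update b j 1)) :
    HasCliffordRoot a b := by
  have hx : ∀ b : Fin n → ZMod 2, a j = 1 → b j = 0 →
      HasCliffordRoot (Function.update a j 0) (Function.update b j 1) →
      HasCliffordRoot a b := by
    intro b ha hb H
    refine HasCliffordRoot.of_conj (hadamard_mem_cliffords j) (hadamard_mul_weyl j a b) ?_
    rwa [ha, hb]
  rcases ZMod.two_eq_zero_or_one (a j) with ha | ha <;>
    rcases ZMod.two_eq_zero_or_one (b j) with hb | hb
  · simp [ha, hb] at hj
  · rwa [← ha, ← hb, Function.update_eq_self, Function.update_eq_self] at H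
  · exact hx b ha hb H
  · refine HasCliffordRoot.of_conj (phaseS_mem_cliffords j) (phaseS_mul_weyl j a b) ?_
    refine hx _ ha ?_ ?_
    · simp [ha, hb, show (1 + 1 : ZMod 2) = 0 from rfl]
    · simpa using H

/-- Induction on the number of qubits on which the operator acts nontrivially. Two nontrivial
factors are rotated to `Z ⊗ Z`, which a controlled-NOT reduces to a single `Z`. The process ends at
some `Z_j`, whose root is the phase gate, or at the identity. -/
theorem hasCliffordRoot {n : ℕ} (i : Fin n) (a b : Fin n → ZMod 2) : HasCliffordRoot a b := by
  classical
  induction hw : (Finset.univ.filter fun k => a k ≠ 0 ∨ b k ≠ 0).card using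
    Nat.strong_induction_on generalizing a b with
  | _ w ih =>
  by_cases h0 : ∃ j, a j ≠ 0 ∨ b j ≠ 0
  swap
  · push Not at h0
    obtain rfl : a = 0 := funext fun k => (h0 k).1
    obtain rfl : b = 0 := funext fun k => (h0 k).2
    exact hasCliffordRoot_zero i
  obtain ⟨j, hj⟩ := h0
  by_cases h1 : ∃ k, k ≠ j ∧ (a k ≠ 0 ∨ b k ≠ 0)
  · obtain ⟨k, hkj, hk⟩ := h1
    refine HasCliffordRoot.of_update hj (HasCliffordRoot.of_update (j := k) ?_ ?_)
    · simpa [hkj] using hk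
    refine HasCliffordRoot.of_conj (cnot_mem_cliffords hkj.symm)
      ((cnot_mul_weyl hkj.symm _ _).trans (one_smul ℂ _).symm) ?_
    refine ih _ ?_ _ _ rfl
    rw [← hw]
    refine Finset.card_lt_card (Finset.ssubset_iff_of_subset ?_ |>.2 ⟨j, ?_, ?_⟩)
    · intro l
      by_cases hlj : l = j
      · subst hlj; simp [hj]
      by_cases hlk : l = k
      · subst hlk; simp [hk]
      simp [hlj, hlk, Ne.symm hkj]
    · simpa using hj
    -- The controlled-NOT adds the `Z`-exponent of the target `k` to that of the control `j`, and `1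
    -- + 1 = 0` clears qubit `j`.
    · simp [Ne.symm hkj, show (1 + 1 : ZMod 2) = 0 from rfl]
  · push Not at h1
    refine HasCliffordRoot.of_update hj ?_
    have ha : Function.update a j 0 = 0 := by
      funext k
      by_cases hk : k = j
      · subst hk; simp
      · simp [hk, (h1 k hk).1]
    have hb : Function.update b j 1 = Pi.single j 1 := by
      funext k
      by_cases hk : k = j
      · subst hk; simp
      · simp [hk, (h1 k hk).2]
    rw [ha, hb]
    exact hasCliffordRoot_single j

theorem IsPauli.pauliRoot_mem {n : ℕ} (i : Fin n) {P : QMat n} (hP : IsPauli P)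
    (h : P * P = 1) : pauliRoot P ∈ cliffords n := by
  obtain ⟨c, a, b, -, rfl⟩ := hP
  exact hasCliffordRoot i a b c h

theorem IsPauli.mem_cliffords {n : ℕ} (i : Fin n) {P : QMat n} (hP : IsPauli P)
    (h : P * P = 1) : P ∈ cliffords n := by
  have := hP.pauliRoot_mem i h
  rw [← pauliRoot_mul_self h]
  exact mul_mem_cliffords this this

/-! ### Decompositions of bounded `ℓ₁`-norm -/

/-- `M` has a decomposition over `S` with coefficients of `ℓ₁`-norm at most `r`. -/
def HasBoundedDecomposition {n : ℕ} (S : Set (QMat n)) (r : ℝ) (M : QMat n) : Prop :=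
  ∃ x : S →₀ ℂ, IsDecomposition x M ∧ (x.sum fun _ c => ‖c‖) ≤ r

namespace HasBoundedDecomposition

variable {n : ℕ} {S T : Set (QMat n)}

theorem zero : HasBoundedDecomposition S 0 0 :=
  ⟨0, by simp [IsDecomposition], by simp⟩

theorem mono {r s : ℝ} {M : QMat n} (h : HasBoundedDecomposition S r M) (hrs : r ≤ s) :
    HasBoundedDecomposition S s M := by
  obtain ⟨x, hx, hr⟩ := h
  exact ⟨x, hx, hr.trans hrs⟩

theorem smul_mem {C : QMat n} (hC : C ∈ S) (c : ℂ) :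
    HasBoundedDecomposition S ‖c‖ (c • C) := by
  refine ⟨Finsupp.single ⟨C, hC⟩ c, ?_, ?_⟩
  · simp [IsDecomposition]
  · simp

theorem add {r s : ℝ} {M N : QMat n} (hM : HasBoundedDecomposition S r M)
    (hN : HasBoundedDecomposition S s N) : HasBoundedDecomposition S (r + s) (M + N) := by
  classical
  obtain ⟨x, hx, hr⟩ := hM
  obtain ⟨y, hy, hs⟩ := hN
  refine ⟨x + y, ?_, ?_⟩
  · rw [IsDecomposition] at *
    rw [Finsupp.sum_add_index' (by simp) (by intros; rw [add_smul]), ← hx, ← hy]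
  · refine le_trans ?_ (add_le_add hr hs)
    rw [Finsupp.sum_of_support_subset x (Finset.subset_union_left (s₂ := y.support)) _ (by simp),
      Finsupp.sum_of_support_subset y (Finset.subset_union_right (s₁ := x.support)) _ (by simp),
      Finsupp.sum_of_support_subset (x + y) Finsupp.support_add _ (by simp),
      ← Finset.sum_add_distrib]
    exact Finset.sum_le_sum fun i _ => norm_add_le _ _

theorem sum {ι : Type*} (s : Finset ι) {r : ι → ℝ} {M : ι → QMat n}
    (h : ∀ i ∈ s, HasBoundedDecomposition S (r i) (M i)) :
    HasBoundedDecomposition S (∑ i ∈ s, r i) (∑ i ∈ s, M i) := by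
  classical
  induction s using Finset.induction_on with
  | empty => exact zero
  | insert a s ha ih =>
    rw [Finset.sum_insert ha, Finset.sum_insert ha]
    exact (h a (Finset.mem_insert_self a s)).add
      (ih fun i hi => h i (Finset.mem_insert_of_mem hi))

/-- An additive map that contracts `S` into the hull of `T` does so for the hull of `S`. -/
theorem map (Φ : QMat n →+ QMat n)
    (h : ∀ C ∈ S, ∀ c : ℂ, HasBoundedDecomposition T ‖c‖ (Φ (c • C))) {r : ℝ} {M : QMat n}
    (hM : HasBoundedDecomposition S r M) : HasBoundedDecomposition T r (Φ M) := by
  obtain ⟨x, hx, hr⟩ := hM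
  rw [IsDecomposition] at hx
  rw [hx, Finsupp.sum, map_sum]
  exact (sum x.support fun C _ => h C C.2 (x C)).mono hr

theorem mono_set (hST : S ⊆ T) {r : ℝ} {M : QMat n} (hM : HasBoundedDecomposition S r M) :
    HasBoundedDecomposition T r M :=
  hM.map (AddMonoidHom.id _) fun _ hC c => smul_mem (hST hC) c

end HasBoundedDecomposition

/-! ### Projection onto diagonal Clifford unitaries -/

/-- The operator `Z` on qubit `j`. -/
def zGate {n : ℕ} (j : Fin n) : QMat n := weyl 0 (Pi.single j 1)

theorem zGate_mul_self {n : ℕ} (j : Fin n) : zGate j * zGate j = 1 := by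
  simp [zGate, weyl_sq]

theorem isPauli_zGate {n : ℕ} (j : Fin n) : IsPauli (zGate j) := isPauli_weyl _ _

theorem weyl_zero_mul_apply {n : ℕ} (q : Fin n → ZMod 2) (M : QMat n) (x y : Fin n → ZMod 2) :
    (weyl 0 q * M) x y = zmodSign (q ⬝ᵥ x) * M x y := by
  simp [Matrix.mul_apply, weyl]

theorem mul_weyl_zero_apply {n : ℕ} (q : Fin n → ZMod 2) (M : QMat n) (x y : Fin n → ZMod 2) :
    (M * weyl 0 q) x y = M x y * zmodSign (q ⬝ᵥ y) := by
  simp [Matrix.mul_apply, weyl]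

/-- A nonzero entry `M x y` forces `x` and `y` to agree wherever `q` is nonzero, so both products
carry the same sign there. -/
theorem commute_weyl_zero {n : ℕ} {q : Fin n → ZMod 2} {M : QMat n}
    (h : ∀ j, q j ≠ 0 → Commute (zGate j) M) : Commute (weyl 0 q) M := by
  ext x y
  rw [weyl_zero_mul_apply, mul_weyl_zero_apply, mul_comm]
  by_cases hM : M x y = 0
  · simp [hM]
  congr 2
  refine Finset.sum_congr rfl fun j _ => ?_
  by_cases hq : q j = 0
  · simp [hq]
  have := congrFun (congrFun (h j hq).eq x) y
  rw [zGate, weyl_zero_mul_apply, mul_weyl_zero_apply, mul_comm, mul_right_inj' hM] at this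
  simp only [single_dotProduct, one_mul] at this
  congr 1
  have h0 : zmodSign (x j + y j) = 1 := by rw [zmodSign_add, this, zmodSign_mul_self]
  exact CharTwo.add_eq_zero.1 (zmodSign_eq_one h0)

/-- The Clifford unitaries commuting with the operators `Z` on the qubits in `J`. -/
def commutingCliffords {n : ℕ} (J : Finset (Fin n)) : Set (QMat n) :=
  {C | C ∈ cliffords n ∧ ∀ j ∈ J, Commute (zGate j) C}

theorem weyl_mul_self_mul {n : ℕ} (a b : Fin n → ZMod 2) (M : QMat n) :
    weyl a b * (weyl a b * M) = zmodSign (b ⬝ᵥ a) • M := by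
  rw [← mul_assoc, weyl_sq, smul_mul_assoc, one_mul]

theorem weyl_mul_left_cancel {n : ℕ} {a b : Fin n → ZMod 2} {M N : QMat n}
    (h : weyl a b * M = weyl a b * N) : M = N := by
  have := congrArg (weyl a b * ·) h
  simp only [weyl_mul_self_mul] at this
  exact (smul_right_injective _ (zmodSign_ne_zero _)) this

theorem apply_eq_zero_of_commute_zGate {n : ℕ} {a b : Fin n → ZMod 2} {c : ℂ} (hc : c ≠ 0)
    {j : Fin n} (h : Commute (zGate j) (c • weyl a b)) : a j = 0 := by
  have h1 := h.eq
  rw [mul_smul_comm, smul_mul_assoc] at h1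
  have h2 := smul_right_injective _ hc h1
  simp only [zGate] at h2
  rw [weyl_mul_comm, ← mul_smul_comm] at h2
  have h3 := congrFun (congrFun (weyl_mul_left_cancel h2) 0) 0
  refine zmodSign_eq_one ?_
  simpa [weyl] using h3

theorem commute_of_mul_right {n : ℕ} {C P Q : QMat n} (hC : C ∈ cliffords n)
    (h : P * Q * C = Q * P * C) : Commute P Q := by
  have := congrArg (· * C.conjTranspose) h
  rw [commute_iff_eq]
  simpa only [mul_assoc, cliffords_mul_conjTranspose hC, mul_one] using this

/-- A Pauli involution that anticommutes with `Z_k` and with its image under `C`, and commutes with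
the `Z_j`, `j ∈ J`, that `C` commutes with. -/
theorem exists_anticommuting_pauli {n : ℕ} {J : Finset (Fin n)} {k : Fin n} (hk : k ∉ J)
    {C Q : QMat n} (hC : C ∈ commutingCliffords J) (hQ : IsPauli Q) (hCQ : C * zGate k = Q * C)
    (hJQ : ∀ j ∈ J, Commute (zGate j) Q) (hkQ : Commute (zGate k) Q) :
    ∃ A, IsPauli A ∧ A * A = 1 ∧ A * zGate k = -(zGate k * A) ∧ A * Q = -(Q * A) ∧
      ∀ j ∈ J, Commute (zGate j) A := by
  obtain ⟨c, p, q, hc4, rfl⟩ := hQ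
  have hc : c ≠ 0 := by rintro rfl; norm_num at hc4
  have hpJ : ∀ j ∈ J, p j = 0 := fun j hj => apply_eq_zero_of_commute_zGate hc (hJQ j hj)
  have hpk : p k = 0 := apply_eq_zero_of_commute_zGate hc hkQ
  -- The search for `A = X^a Z^b` becomes a linear-algebra problem over `ZMod 2`. The four
  -- conditions encode, in order, `A² = 1`, anticommutation with `Z_k`, anticommutation with `Q`,
  -- and commutation with the `Z_j` for `j ∈ J`.
  have key : ∀ a b : Fin n → ZMod 2, b ⬝ᵥ a = 0 → a k = 1 → b ⬝ᵥ p + a ⬝ᵥ q = 1 →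
      (∀ j ∈ J, a j = 0) → ∃ A, IsPauli A ∧ A * A = 1 ∧ A * zGate k = -(zGate k * A) ∧
      A * (c • weyl p q) = -((c • weyl p q) * A) ∧ ∀ j ∈ J, Commute (zGate j) A := by
    intro a b hab hak hpq haJ
    refine ⟨weyl a b, isPauli_weyl a b, by simp [weyl_sq, hab], ?_, ?_, fun j hj => ?_⟩
    · rw [zGate, weyl_mul_comm]
      simp [hak]
    · rw [mul_smul_comm, weyl_mul_comm, hpq]
      simp
    · refine Commute.symm ?_
      rw [commute_iff_eq, zGate, weyl_mul_comm]
      simp [haJ j hj]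
  have hkJ : ∀ j ∈ J, j ≠ k := by rintro j hj rfl; exact hk hj
  by_cases hp : ∃ l, p l ≠ 0
  · obtain ⟨l, hl⟩ := hp
    have hl1 : p l = 1 := (ZMod.two_eq_zero_or_one _).resolve_left hl
    have hlk : l ≠ k := by rintro rfl; exact hl hpk
    -- The exponent `1 + q k` corrects the contribution `q k` of `X_k`, so that the total is `1`.
    refine key (Pi.single k 1) (Pi.single l (1 + q k)) ?_ ?_ ?_ fun j hj => ?_
    · simp [hlk]
    · simp
    · simp [hl1, add_assoc, CharTwo.add_self_eq_zero]
    · simp [hkJ j hj]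
  push Not at hp
  obtain rfl : p = 0 := funext hp
  rcases ZMod.two_eq_zero_or_one (q k) with hqk | hqk
  · by_cases hl : ∃ l, l ∉ J ∧ q l ≠ 0
    · obtain ⟨l, hlJ, hl⟩ := hl
      have hl1 : q l = 1 := (ZMod.two_eq_zero_or_one _).resolve_left hl
      have hlk : k ≠ l := by rintro rfl; exact hl hqk
      refine key (Pi.single k 1 + Pi.single l 1) 0 ?_ ?_ ?_ fun j hj => ?_
      · simp
      · simp [hlk]
      · simp [hqk, hl1, add_dotProduct]
      · have : j ≠ l := by rintro rfl; exact hlJ hj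
        simp [hkJ j hj, this]
    -- Now `Q` is a product of `Z_j` with `j ∈ J`, up to a scalar, so it commutes with `C`. Then `C
    -- Z_k = Q C = C Q` gives `Z_k = Q`, impossible since `q k = 0`: the diagonal entries at `0` and
    -- at `Pi.single k 1` disagree.
    · exfalso
      push Not at hl
      have hcomm : Commute (weyl 0 q) C := by
        refine commute_weyl_zero fun j hj => hC.2 j ?_
        by_contra hjJ
        exact hj (hl j hjJ)
      have h1 : C * zGate k = C * (c • weyl 0 q) := by
        rw [hCQ, smul_mul_assoc, hcomm.eq, mul_smul_comm]
      have h2 : zGate k = c • weyl 0 q := by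
        have := congrArg (C.conjTranspose * ·) h1
        simpa only [← mul_assoc, cliffords_conjTranspose_mul hC.1, one_mul] using this
      have e0 := congrFun (congrFun h2 0) 0
      have e1 := congrFun (congrFun h2 (Pi.single k 1)) (Pi.single k 1)
      simp [zGate, weyl, hqk] at e0 e1
      rw [← e0] at e1
      norm_num at e1
  · refine key (Pi.single k 1) 0 ?_ ?_ ?_ fun j hj => ?_
    · simp
    · simp
    · simp [hqk]
    · simp [hkJ j hj]

/-- For commuting involutions, the `P`-controlled `A` is a product of square roots. -/
theorem controlled_eq_pauliRoot {n : ℕ} {P A : QMat n} (hP : P * P = 1) (hA : A * A = 1)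
    (hPA : A * P = P * A) :
    (1 / 2 : ℂ) • (1 + P + A - P * A) =
      pauliRoot P * pauliRoot A * (pauliRoot (P * A) * (P * A)) := by
  have h1 : P * (P * A) = A := by rw [← mul_assoc, hP, one_mul]
  have h2 : A * (P * A) = P := by rw [← mul_assoc, hPA, mul_assoc, hA, mul_one]
  have h3 : P * A * (P * A) = 1 := by rw [mul_assoc, h2, hP]
  -- On a joint eigenspace `P = (-1)^s`, `A = (-1)^t`, the left side is `(-1)^(s t)`. The last
  -- factor on the right is the inverse root of `P A`, so the right side is `i^(s + t - (s ⊕ t)) =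
  -- i^(2 s t)`.
  rw [pauliRoot_mul h3]
  simp only [pauliRoot, add_mul, mul_add, smul_mul_assoc, mul_smul_comm, mul_one, one_mul, h1, h2,
    h3, smul_smul, smul_add]
  have hI := Complex.I_sq
  match_scalars <;> grind

theorem controlled_mem_cliffords {n : ℕ} (i : Fin n) {P A : QMat n} (hP : IsPauli P)
    (hA : IsPauli A) (hPP : P * P = 1) (hAA : A * A = 1) (hPA : A * P = P * A) :
    (1 / 2 : ℂ) • (1 + P + A - P * A) ∈ cliffords n := by
  have h3 : P * A * (P * A) = 1 := by
    rw [mul_assoc, ← mul_assoc A, hPA, mul_assoc, hAA, mul_one, hPP]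
  rw [controlled_eq_pauliRoot hPP hAA hPA]
  exact mul_mem_cliffords (mul_mem_cliffords (hP.pauliRoot_mem i hPP) (hA.pauliRoot_mem i hAA))
    (mul_mem_cliffords ((hP.mul hA).pauliRoot_mem i h3) ((hP.mul hA).mem_cliffords i h3))

theorem pauliRoot_I_smul {n : ℕ} (P : QMat n) :
    pauliRoot (Complex.I • P) = ((1 + Complex.I) / 2) • (1 + P) := by
  rw [pauliRoot]
  have hI := Complex.I_sq
  match_scalars <;> grind

/-- The average of a matrix over conjugation with `Z` on qubit `k`. -/
noncomputable def zAverage {n : ℕ} (k : Fin n) : QMat n →ₗ[ℂ] QMat n where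
  toFun M := (1 / 2 : ℂ) • (M + zGate k * M * zGate k)
  map_add' M N := by rw [mul_add, add_mul, add_add_add_comm, smul_add]
  map_smul' c M := by
    rw [mul_smul_comm, smul_mul_assoc, ← smul_add, smul_comm, RingHom.id_apply]

theorem zAverage_apply {n : ℕ} (k : Fin n) (M : QMat n) :
    zAverage k M = (1 / 2 : ℂ) • (M + zGate k * M * zGate k) := rfl

/-- The contraction behind the diagonal case. The cases are whether `Z_k` commutes or anticommutes
with its image `Q` under conjugation by `C`. -/
theorem zAverage_commutingCliffords {n : ℕ} {J : Finset (Fin n)} {k : Fin n} (hk : k ∉ J)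
    {C : QMat n} (hC : C ∈ commutingCliffords J) (c : ℂ) :
    HasBoundedDecomposition (commutingCliffords (insert k J)) ‖c‖ (zAverage k (c • C)) := by
  obtain ⟨Q, hQ, hCQ⟩ := cliffords_mul_isPauli hC.1 _ (isPauli_zGate k)
  have hZ := zGate_mul_self k
  have hQQ : Q * Q = 1 := by
    have : Q * Q * C = 1 * C := by
      rw [mul_assoc, ← hCQ, ← mul_assoc, ← hCQ, mul_assoc, hZ, mul_one, one_mul]
    have := congrArg (· * C.conjTranspose) this
    simpa only [mul_assoc, cliffords_mul_conjTranspose hC.1, mul_one, one_mul] using this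
  have hZJ : ∀ j, Commute (zGate j) (zGate k) := fun j => by
    rw [commute_iff_eq, zGate, zGate, weyl_mul_comm]; simp
  have hJQ : ∀ j ∈ J, Commute (zGate j) Q := fun j hj => by
    refine commute_of_mul_right hC.1 ?_
    rw [mul_assoc, ← hCQ, ← mul_assoc, (hC.2 j hj).eq, mul_assoc, (hZJ j).eq, ← mul_assoc, hCQ,
      mul_assoc, mul_assoc, (hC.2 j hj).eq]
  set P := zGate k * Q with hP
  have hPp : IsPauli P := (isPauli_zGate k).mul hQ
  have hJP : ∀ j ∈ J, Commute (zGate j) P := fun j hj => (hZJ j).mul_right (hJQ j hj)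
  have hZP : zGate k * P = Q := by rw [hP, ← mul_assoc, hZ, one_mul]
  have hav : zAverage k C = (1 / 2 : ℂ) • ((1 + P) * C) := by
    rw [zAverage_apply, mul_assoc, hCQ, ← mul_assoc, ← hP, add_mul, one_mul]
  rw [map_smul, hav]
  rcases (isPauli_zGate k).mul_eq_or hQ with hcomm | hanti
  · have hPP : P * P = 1 := by
      rw [hP, mul_assoc, ← mul_assoc Q, ← hcomm, mul_assoc, hQQ, mul_one, hZ]
    obtain ⟨A, hA, hAA, hAZ, hAQ, hJA⟩ := exists_anticommuting_pauli hk hC hQ hCQ hJQ hcomm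
    have hAP : A * P = P * A := by
      rw [hP, ← mul_assoc, hAZ, neg_mul, mul_assoc, hAQ, mul_neg, neg_neg, mul_assoc]
    -- `V` is the identity where `P = 1`, where `Q` and `Z_k` agree, and equals `A` where `P = -1`,
    -- where they differ by a sign that conjugation by `A` removes.
    set V := (1 / 2 : ℂ) • (1 + P + A - P * A) with hV
    have hVmem : V ∈ cliffords n := controlled_mem_cliffords k hPp hA hPP hAA hAP
    have hPVC : (1 + P) * V = 1 + P := by
      rw [hV, mul_smul_comm]
      have h1 : P * (P * A) = A := by rw [← mul_assoc, hPP, one_mul]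
      have : (1 + P) * (1 + P + A - P * A) = (2 : ℂ) • (1 + P) := by
        simp only [add_mul, mul_add, mul_sub, one_mul, mul_one, hPP, h1]
        module
      rw [this, smul_smul]; norm_num
    have hPZ : P * zGate k = Q := by rw [hP, hcomm, mul_assoc, hZ, mul_one]
    have hVQ : V * Q = zGate k * V := by
      rw [hV, smul_mul_assoc, mul_smul_comm]
      congr 1
      have h1 : P * Q = zGate k := by rw [hP, mul_assoc, hQQ, mul_one]
      have h2 : A * Q = -(zGate k * (P * A)) := by rw [hAQ, ← hZP, mul_assoc]
      have h3 : P * A * Q = -(zGate k * A) := by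
        rw [mul_assoc, hAQ, mul_neg, ← mul_assoc, h1]
      simp only [add_mul, sub_mul, mul_add, mul_sub, one_mul, mul_one, h1, h2, h3, hZP]
      abel
    have hD : V * C ∈ commutingCliffords (insert k J) := by
      refine ⟨mul_mem_cliffords hVmem hC.1, fun j hj => ?_⟩
      rcases Finset.mem_insert.1 hj with rfl | hj
      · rw [commute_iff_eq, mul_assoc, hCQ, ← mul_assoc, ← mul_assoc, hVQ]
      · refine Commute.mul_right ?_ (hC.2 j hj)
        exact ((((Commute.one_right _).add_right (hJP j hj)).add_right (hJA j hj)).sub_right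
          ((hJP j hj).mul_right (hJA j hj))).smul_right _
    have hPD : P * (V * C) ∈ commutingCliffords (insert k J) := by
      refine ⟨mul_mem_cliffords (hPp.mem_cliffords k hPP) hD.1, fun j hj => ?_⟩
      refine Commute.mul_right ?_ (hD.2 j hj)
      rcases Finset.mem_insert.1 hj with rfl | hj
      · rw [commute_iff_eq, hZP, hPZ]
      · exact hJP j hj
    have heq : c • (1 / 2 : ℂ) • ((1 + P) * C) =
        (c / 2) • (V * C) + (c / 2) • (P * (V * C)) := by
      rw [← hPVC, ← smul_add, smul_smul, mul_assoc, add_mul, one_mul]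
      congr 1; ring
    rw [heq]
    refine ((HasBoundedDecomposition.smul_mem hD _).add
      (HasBoundedDecomposition.smul_mem hPD _)).mono ?_
    rw [norm_div, Complex.norm_ofNat]; linarith
  -- Here `P² = -1`, so `i P` is an involution whose root is the unitary `((1 + i) / 2) (1 + P)`.
  · have hIP : (Complex.I • P) * (Complex.I • P) = 1 := by
      rw [smul_mul_smul_comm, hP, mul_assoc, ← mul_assoc Q, ← neg_eq_iff_eq_neg.2 hanti, neg_mul,
        mul_assoc, hQQ, mul_one, mul_neg, hZ, Complex.I_mul_I, smul_neg, neg_one_smul, neg_neg]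
    have hroot := (hPp.smul Complex.I_pow_four).pauliRoot_mem k hIP
    rw [pauliRoot_I_smul] at hroot
    have hD : (((1 + Complex.I) / 2) • (1 + P)) * C ∈ commutingCliffords (insert k J) := by
      refine ⟨mul_mem_cliffords hroot hC.1, fun j hj => ?_⟩
      rcases Finset.mem_insert.1 hj with rfl | hj
      · rw [smul_mul_assoc]
        refine Commute.smul_right ?_ _
        rw [commute_iff_eq, ← mul_assoc, mul_assoc _ C, hCQ, ← mul_assoc, mul_add, add_mul 1 P Q,
          mul_one, one_mul, hZP, hP, mul_assoc, hQQ, mul_one, add_comm]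
      · exact (((Commute.one_right _).add_right (hJP j hj)).smul_right _).mul_right (hC.2 j hj)
    have hne : (1 + Complex.I) ≠ 0 := by
      intro h; simpa using congrArg Complex.re h
    have heq : c • (1 / 2 : ℂ) • ((1 + P) * C) =
        (c / (1 + Complex.I)) • ((((1 + Complex.I) / 2) • (1 + P)) * C) := by
      rw [smul_mul_assoc, smul_smul, smul_smul]
      congr 1; field_simp
    rw [heq]
    refine (HasBoundedDecomposition.smul_mem hD _).mono ?_
    rw [norm_div]
    -- The coefficient has norm `‖c‖ / √2`; the crude bound `1 ≤ ‖1 + i‖` is enough.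
    refine div_le_self (norm_nonneg c) ?_
    simpa using Complex.abs_re_le_norm (1 + Complex.I)

/-! ### Projection onto real Clifford unitaries -/

theorem exists_sqrt_smul_mem_cliffords {n : ℕ} (i : Fin n) {c : ℂ} (hc : c ^ 4 = 1) :
    ∃ μ : ℂ, μ * μ = c ∧ μ • (1 : QMat n) ∈ cliffords n := by
  have hI := I_smul_one_mem_cliffords i
  have hω := omegaEight_mem_cliffords i
  have hω2 := omegaEight_sq
  have h : (c - 1) * (c + 1) * ((c - Complex.I) * (c + Complex.I)) = 0 := by
    linear_combination hc + (1 - c ^ 2) * Complex.I_sq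
  rcases mul_eq_zero.1 h with h | h <;> rcases mul_eq_zero.1 h with h | h
  · exact ⟨1, by linear_combination -h, by simpa using one_mem_cliffords n⟩
  · exact ⟨Complex.I, by linear_combination Complex.I_sq - h, hI⟩
  · exact ⟨omegaEight, by linear_combination hω2 - h, hω⟩
  · refine ⟨Complex.I * omegaEight, ?_, ?_⟩
    · linear_combination Complex.I ^ 2 * hω2 + Complex.I * Complex.I_sq - h
    · rw [← smul_smul]
      exact smul_mem_cliffords hI hω

theorem map_star_smul {n : ℕ} (c : ℂ) (M : QMat n) :
    (c • M).map (starRingEnd ℂ) = (starRingEnd ℂ) c • M.map (starRingEnd ℂ) := by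
  ext x y; simp

theorem map_star_add {n : ℕ} (M N : QMat n) :
    (M + N).map (starRingEnd ℂ) = M.map (starRingEnd ℂ) + N.map (starRingEnd ℂ) := by
  ext x y; simp

theorem map_star_map_star {n : ℕ} (M : QMat n) :
    (M.map (starRingEnd ℂ)).map (starRingEnd ℂ) = M := by
  ext x y; simp

/-- For real `P`, conjugation exchanges the eigenvalues `i` and `-i` of the root, which is what
multiplication by `P` does. -/
theorem pauliRoot_map_star {n : ℕ} {P : QMat n} (h : P * P = 1)
    (hP : P.map (starRingEnd ℂ) = P) : (pauliRoot P).map (starRingEnd ℂ) = pauliRoot P * P := by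
  rw [pauliRoot_mul h, pauliRoot, map_star_add, map_star_smul, map_star_smul, hP,
    Matrix.map_one _ (map_zero _) (map_one _)]
  simp [sub_eq_add_neg, map_ofNat]

/-- The entrywise real part of a matrix. -/
noncomputable def realAverage (n : ℕ) : QMat n →+ QMat n where
  toFun M := (1 / 2 : ℂ) • (M + M.map (starRingEnd ℂ))
  map_zero' := by simp
  map_add' M N := by rw [map_star_add, add_add_add_comm, smul_add]

theorem realAverage_apply {n : ℕ} (M : QMat n) :
    realAverage n M = (1 / 2 : ℂ) • (M + M.map (starRingEnd ℂ)) := rfl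

/-- The left side equals `max(|Re y|, |Im y|)`. -/
theorem norm_half_add_norm_half_sub_le (y : ℂ) :
    ‖(((y.re + y.im) / 2 : ℝ) : ℂ)‖ + ‖(((y.re - y.im) / 2 : ℝ) : ℂ)‖ ≤ ‖y‖ := by
  have h1 := abs_le.1 (Complex.abs_re_le_norm y)
  have h2 := abs_le.1 (Complex.abs_im_le_norm y)
  rw [Complex.norm_real, Complex.norm_real, Real.norm_eq_abs, Real.norm_eq_abs]
  rcases abs_cases ((y.re + y.im) / 2) with h | h <;>
    rcases abs_cases ((y.re - y.im) / 2) with h' | h' <;> linarith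

/-- The contraction behind the real case. Carrying `J` along lets it be applied after the diagonal
projection. -/
theorem realAverage_commutingCliffords {n : ℕ} {J : Finset (Fin n)} {C : QMat n}
    (hC : C ∈ commutingCliffords J) (y : ℂ) :
    HasBoundedDecomposition {D | D ∈ commutingCliffords J ∧ D.map (starRingEnd ℂ) = D} ‖y‖
      (realAverage n (y • C)) := by
  rw [realAverage_apply, map_star_smul]
  -- With no qubits the Clifford group is trivial and the phases used below are missing, but then `C
  -- = 1` is already real.
  rcases n with _ | n
  · have h1 := cliffords_zero hC.1
    have hstar : C.map (starRingEnd ℂ) = C := by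
      rw [h1, Matrix.map_one _ (map_zero _) (map_one _)]
    rw [hstar, ← add_smul, smul_smul, Complex.add_conj]
    refine (HasBoundedDecomposition.smul_mem
      (S := {D | D ∈ commutingCliffords J ∧ D.map (starRingEnd ℂ) = D}) ⟨hC, hstar⟩ _).mono ?_
    simpa using Complex.abs_re_le_norm y
  obtain ⟨_, ⟨c, a, b, hc, rfl⟩, hCP⟩ := cliffords_map_star hC.1
  -- Multiplying `C` by a square root of `c` absorbs the phase: since `conj μ * c = μ`, the
  -- conjugate of `D = μ C` is exactly `W D`.
  obtain ⟨μ, hμc, hμ⟩ := exists_sqrt_smul_mem_cliffords (0 : Fin (n + 1)) hc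
  have hμnorm : ‖μ‖ = 1 :=
    Complex.norm_eq_one_of_pow_eq_one (n := 8) (by rw [← hc, ← hμc]; ring) (by norm_num)
  have hμstar : (starRingEnd ℂ) μ * μ = 1 := by
    rw [Complex.conj_mul', hμnorm]; norm_num
  set W := weyl a b with hW
  set D := μ • C with hDdef
  have hD : D ∈ cliffords (n + 1) := smul_mem_cliffords hμ hC.1
  have hDstar : D.map (starRingEnd ℂ) = W * D := by
    rw [hDdef, map_star_smul, hCP, smul_mul_assoc, smul_smul, ← hμc, ← mul_assoc, hμstar, one_mul,
      mul_smul_comm]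
  have hWstar : W.map (starRingEnd ℂ) = W := weyl_map_star a b
  -- Conjugating twice gives `D = W W D`, because `W` is real.
  have hWW : W * W = 1 := by
    have h := map_star_map_star D
    rw [hDstar, Matrix.map_mul, hWstar, hDstar, ← mul_assoc] at h
    have := congrArg (· * D.conjTranspose) h
    simpa only [mul_assoc, cliffords_mul_conjTranspose hD, mul_one] using this
  have hJD : ∀ j ∈ J, Commute (zGate j) D := fun j hj => (hC.2 j hj).smul_right μ
  have hJW : ∀ j ∈ J, Commute (zGate j) W := fun j hj => by
    refine commute_of_mul_right hD ?_
    have h := congrArg (fun M : QMat (n + 1) => M.map (starRingEnd ℂ)) (hJD j hj).eq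
    simp only [Matrix.map_mul, hDstar] at h
    rw [show (zGate j).map (starRingEnd ℂ) = zGate j from weyl_map_star _ _] at h
    rw [mul_assoc, h, mul_assoc, mul_assoc, (hJD j hj).eq]
  have hroot : pauliRoot W ∈ cliffords (n + 1) := (isPauli_weyl a b).pauliRoot_mem 0 hWW
  have hJroot : ∀ j ∈ J, Commute (zGate j) (pauliRoot W) := fun j hj =>
    ((Commute.one_right _).smul_right _).add_right ((hJW j hj).smul_right _)
  have hrs := pauliRoot_map_star hWW hWstar
  have hD1 : pauliRoot W * D ∈ {D | D ∈ commutingCliffords J ∧ D.map (starRingEnd ℂ) = D} := by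
    refine ⟨⟨mul_mem_cliffords hroot hD, fun j hj => (hJroot j hj).mul_right (hJD j hj)⟩, ?_⟩
    rw [Matrix.map_mul, hrs, hDstar, mul_assoc, ← mul_assoc W W, hWW, one_mul]
  have hD2 : pauliRoot W * W * D ∈
      {D | D ∈ commutingCliffords J ∧ D.map (starRingEnd ℂ) = D} := by
    refine ⟨⟨mul_mem_cliffords (mul_mem_cliffords hroot
      ((isPauli_weyl a b).mem_cliffords 0 hWW)) hD, fun j hj =>
      ((hJroot j hj).mul_right (hJW j hj)).mul_right (hJD j hj)⟩, ?_⟩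
    rw [Matrix.map_mul, Matrix.map_mul, hrs, hDstar, hWstar, mul_assoc _ W W, hWW, mul_one,
      mul_assoc]
  set z := y * (starRingEnd ℂ) μ with hz
  have hznorm : ‖z‖ = ‖y‖ := by rw [hz, norm_mul, RCLike.norm_conj, hμnorm, mul_one]
  have hyC : y • C = z • D := by rw [hDdef, smul_smul, hz, mul_assoc, hμstar, mul_one]
  have heq : (1 / 2 : ℂ) • (y • C + (starRingEnd ℂ) y • C.map (starRingEnd ℂ)) =
      (((z.re + z.im) / 2 : ℝ) : ℂ) • (pauliRoot W * D) +
        (((z.re - z.im) / 2 : ℝ) : ℂ) • (pauliRoot W * W * D) := by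
    rw [← map_star_smul, hyC, map_star_smul, hDstar, pauliRoot_mul hWW, pauliRoot]
    have hz1 := Complex.re_add_im z
    have hz2 : (starRingEnd ℂ) z = z.re - z.im * Complex.I := by
      apply Complex.ext <;> simp
    rw [hz2]
    simp only [add_mul, smul_mul_assoc, one_mul]
    clear_value z D W
    match_scalars
    · linear_combination -(1 / 2 : ℂ) * hz1
    · ring
  rw [heq, ← hznorm]
  exact ((HasBoundedDecomposition.smul_mem hD1 _).add
    (HasBoundedDecomposition.smul_mem hD2 _)).mono (norm_half_add_norm_half_sub_le z)

/-! ### The Clifford unitaries span all matrices -/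

/-- A Weyl operator squares to `±1`; a factor `i` in the negative case makes it a Pauli involution,
hence Clifford. -/
theorem exists_smul_weyl_mem_cliffords {n : ℕ} (a b : Fin n → ZMod 2) :
    ∃ c : ℂ, c ≠ 0 ∧ c • weyl a b ∈ cliffords n := by
  rcases n with _ | n
  · refine ⟨1, one_ne_zero, ?_⟩
    rw [Subsingleton.elim a 0, Subsingleton.elim b 0, weyl_zero, one_smul]
    exact one_mem_cliffords 0
  · rcases ZMod.two_eq_zero_or_one (b ⬝ᵥ a) with h | h
    · exact ⟨1, one_ne_zero, ((isPauli_weyl a b).smul (one_pow 4)).mem_cliffords 0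
        (by simp [weyl_sq, h])⟩
    · exact ⟨Complex.I, Complex.I_ne_zero, ((isPauli_weyl a b).smul
        Complex.I_pow_four).mem_cliffords 0 (by
          rw [smul_mul_smul_comm, weyl_sq, h]; simp)⟩

theorem sum_zmodSign_dotProduct {n : ℕ} (w : Fin n → ZMod 2) :
    ∑ b, zmodSign (b ⬝ᵥ w) = if w = 0 then 2 ^ n else 0 := by
  split_ifs with h
  · subst h; simp
  · obtain ⟨j, hj⟩ := Function.ne_iff.1 h
    have hj1 : w j = 1 := (ZMod.two_eq_zero_or_one _).resolve_left hj
    -- Flipping bit `j` of `b`, where `w j = 1`, negates every term, so the sum equals its own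
    -- negative.
    have := (Equiv.sum_comp (Equiv.addRight (Pi.single j 1 : Fin n → ZMod 2))
      fun b => zmodSign (b ⬝ᵥ w)).symm
    simp only [Equiv.coe_addRight, add_dotProduct, single_dotProduct, hj1, zmodSign_add,
      zmodSign_one, mul_neg, mul_one, Finset.sum_neg_distrib] at this
    linear_combination this / 2

/-- Fourier inversion in `b`: character orthogonality isolates column `y` of the shift by `x + y`.
-/
theorem single_eq_sum_weyl {n : ℕ} (x y : Fin n → ZMod 2) (t : ℂ) :
    (Matrix.single x y t : QMat n) =
      ∑ b, (t * (2 ^ n)⁻¹ * zmodSign (b ⬝ᵥ y)) • weyl (x + y) b := by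
  ext u v
  simp only [Matrix.sum_apply, Matrix.smul_apply, smul_eq_mul, weyl, Matrix.of_apply, mul_ite,
    mul_zero, Matrix.single_apply]
  have hvy : y + v = 0 ↔ y = v := by
    rw [add_eq_zero_iff_eq_neg, ← eq_neg_of_add_eq_zero_left (bits_add_self v)]
  by_cases hu : u = v + (x + y)
  · simp only [hu, if_true, mul_assoc, ← zmodSign_add, ← dotProduct_add, ← Finset.mul_sum,
      sum_zmodSign_dotProduct, hvy]
    by_cases hy : y = v
    · subst hy
      have : y + (x + y) = x := by rw [add_left_comm, bits_add_self, add_zero]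
      simp [this]
    · simp [hy]
  · simp only [hu, if_false, Finset.sum_const_zero]
    refine if_neg ?_
    rintro ⟨rfl, rfl⟩
    exact hu (by rw [add_left_comm, bits_add_self, add_zero])

theorem exists_hasBoundedDecomposition {n : ℕ} (M : QMat n) :
    ∃ r, HasBoundedDecomposition (cliffords n) r M := by
  have hw : ∀ (a b : Fin n → ZMod 2) (t : ℂ),
      ∃ r, HasBoundedDecomposition (cliffords n) r (t • weyl a b) := by
    intro a b t
    obtain ⟨c, hc, h⟩ := exists_smul_weyl_mem_cliffords a b
    refine ⟨‖t * c⁻¹‖, ?_⟩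
    rw [show t • weyl a b = (t * c⁻¹) • c • weyl a b by
      rw [smul_smul, mul_assoc, inv_mul_cancel₀ hc, mul_one]]
    exact HasBoundedDecomposition.smul_mem h _
  choose r hr using hw
  rw [Matrix.matrix_eq_sum_single M]
  simp only [single_eq_sum_weyl]
  exact ⟨_, HasBoundedDecomposition.sum _ fun x _ => HasBoundedDecomposition.sum _ fun y _ =>
    HasBoundedDecomposition.sum _ fun b _ => hr _ _ _⟩

/-! ### The Clifford group is finite -/

theorem eq_smul_one_of_commute_weyl {n : ℕ} {M : QMat n}
    (h : ∀ a b, Commute (weyl a b) M) : ∃ c : ℂ, M = c • 1 := by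
  have : M ∈ Set.range (Matrix.scalar (Fin n → ZMod 2)) := by
    refine Matrix.mem_range_scalar_of_commute_single fun x y _ => ?_
    change Commute (Matrix.single x y 1) M
    rw [single_eq_sum_weyl]
    exact Commute.sum_left _ _ _ fun b _ => (h _ b).smul_left _
  obtain ⟨c, rfl⟩ := this
  exact ⟨c, by rw [Matrix.scalar_apply, Matrix.smul_one_eq_diagonal]⟩

theorem finite_setOf_pow_eq_one {m : ℕ} (hm : 0 < m) : {c : ℂ | c ^ m = 1}.Finite :=
  (Polynomial.nthRoots m (1 : ℂ)).toFinset.finite_toSet.subset fun c hc => by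
    simpa [Polynomial.mem_nthRoots hm] using hc

theorem finite_isPauli (n : ℕ) : {P : QMat n | IsPauli P}.Finite := by
  have := (((finite_setOf_pow_eq_one (m := 4) (by norm_num)).prod
    (Set.finite_univ (α := (Fin n → ZMod 2) × (Fin n → ZMod 2)))).image
      fun p => p.1 • weyl p.2.1 p.2.2)
  refine this.subset ?_
  rintro P ⟨c, a, b, hc, rfl⟩
  exact ⟨(c, a, b), ⟨hc, trivial⟩, rfl⟩

/-- Conjugation sends the finitely many Weyl operators into the finite set of Paulis, and determines
the Clifford up to a scalar since the Weyl operators span. The determinant makes that scalar a root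
of unity of order dividing `4 * 2 ^ n`. -/
theorem finite_cliffords (n : ℕ) : (cliffords n).Finite := by
  refine Set.Finite.of_finite_fibers
    (fun (C : QMat n) (p : (Fin n → ZMod 2) × (Fin n → ZMod 2)) =>
      C * weyl p.1 p.2 * C.conjTranspose) ?_ ?_
  · refine (Set.Finite.pi' fun _ => finite_isPauli n).subset ?_
    rintro _ ⟨C, hC, rfl⟩ p
    obtain ⟨Q, hQ, h⟩ := cliffords_mul_isPauli hC _ (isPauli_weyl p.1 p.2)
    simpa only [Set.mem_ofPred_eq, h, mul_assoc, cliffords_mul_conjTranspose hC, mul_one] using hQ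
  · rintro _ ⟨C, hC, rfl⟩
    have hm : 0 < Fintype.card (Fin n → ZMod 2) * 4 := by positivity
    refine ((finite_setOf_pow_eq_one hm).image fun c => c • C).subset ?_
    rintro D ⟨hD, hDC⟩
    have hcomm : ∀ a b, Commute (weyl a b) (C.conjTranspose * D) := by
      intro a b
      have h : D * weyl a b * D.conjTranspose = C * weyl a b * C.conjTranspose :=
        congrFun hDC (a, b)
      have h' := congrArg (fun M => C.conjTranspose * M * D) h
      simp only [mul_assoc, cliffords_conjTranspose_mul hD, mul_one] at h'
      rw [← mul_assoc C.conjTranspose C, cliffords_conjTranspose_mul hC, one_mul] at h'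
      rw [commute_iff_eq, ← h', mul_assoc]
    obtain ⟨c, hc⟩ := eq_smul_one_of_commute_weyl hcomm
    have hDc : D = c • C := by
      have := congrArg (C * ·) hc
      simpa only [← mul_assoc, cliffords_mul_conjTranspose hC, one_mul, mul_smul_comm,
        mul_one] using this
    refine ⟨c, ?_, hDc.symm⟩
    have hdet := cliffords_det_pow hD
    rwa [hDc, Matrix.det_smul, mul_pow, cliffords_det_pow hC, mul_one, ← pow_mul] at hdet

/-! ### Existence of optimal decompositions -/

/-- The decompositions form a nonempty closed subset of a finite-dimensional `ℓ₁` space, so one of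
them is nearest to the origin. -/
theorem exists_minimal_decomposition {n : ℕ} {S : Set (QMat n)} (hS : S.Finite) {M : QMat n}
    (hM : ∃ x : S →₀ ℂ, IsDecomposition x M) :
    ∃ x : S →₀ ℂ, IsDecomposition x M ∧ ∀ y : S →₀ ℂ, IsDecomposition y M →
      (x.sum fun _ c => ‖c‖) ≤ y.sum fun _ c => ‖c‖ := by
  classical
  have := hS.fintype
  let F : Set (PiLp 1 fun _ : S => ℂ) := {v | M = ∑ C : S, v C • (C : QMat n)}
  have hF : IsClosed F := by
    refine isClosed_eq continuous_const ?_
    fun_prop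
  have hdec : ∀ x : S →₀ ℂ, IsDecomposition x M ↔ WithLp.toLp 1 (x : S → ℂ) ∈ F := by
    intro x
    rw [IsDecomposition, Finsupp.sum_fintype _ _ (by simp)]
    rfl
  have hnorm : ∀ x : S →₀ ℂ,
      (x.sum fun _ c => ‖c‖) = ‖(WithLp.toLp 1 (x : S → ℂ) : PiLp 1 fun _ : S => ℂ)‖ := by
    intro x
    rw [Finsupp.sum_fintype _ _ (by simp), PiLp.norm_eq_of_L1]
  obtain ⟨x₀, hx₀⟩ := hM
  obtain ⟨v, hv, hmin⟩ := hF.exists_infDist_eq_dist ⟨_, (hdec x₀).1 hx₀⟩ 0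
  have hx : WithLp.toLp 1 ((Finsupp.equivFunOnFinite.symm (WithLp.ofLp v) : S →₀ ℂ) : S → ℂ) = v := by
    simp
  refine ⟨Finsupp.equivFunOnFinite.symm (WithLp.ofLp v), (hdec _).2 (hx ▸ hv), fun y hy => ?_⟩
  rw [hnorm, hnorm, hx, ← dist_zero_left, ← dist_zero_left, ← hmin]
  exact Metric.infDist_le_dist_of_mem ((hdec y).1 hy)

theorem isLeast_costSet {n : ℕ} {S : Set (QMat n)} {M : QMat n} {x : S →₀ ℂ}
    (hx : IsDecomposition x M) (hmin : ∀ y : S →₀ ℂ, IsDecomposition y M →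
      (x.sum fun _ c => ‖c‖) ≤ y.sum fun _ c => ‖c‖) :
    IsLeast (costSet S M) (decompositionCost x) := by
  refine ⟨⟨x, hx, rfl⟩, ?_⟩
  rintro _ ⟨y, hy, rfl⟩
  exact pow_le_pow_left₀ (Finset.sum_nonneg fun _ _ => norm_nonneg _) (hmin y hy) 2

/-- If restricting to `T ⊆ S` does not increase the `ℓ₁`-norm, both minima exist and agree. -/
theorem isLeast_costSet_of_subset {n : ℕ} {S T : Set (QMat n)} (hS : S.Finite) (hTS : T ⊆ S)
    {M : QMat n} (hM : ∃ r, HasBoundedDecomposition S r M)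
    (h : ∀ r, HasBoundedDecomposition S r M → HasBoundedDecomposition T r M) :
    IsLeast (costSet S M) (sInf (costSet S M)) ∧ IsLeast (costSet T M) (sInf (costSet T M)) ∧
      sInf (costSet S M) = sInf (costSet T M) ∧
      ∃ x : S →₀ ℂ, IsDecomposition x M ∧ decompositionCost x = sInf (costSet S M) ∧
        ∀ C ∈ x.support, (C : QMat n) ∈ T := by
  obtain ⟨_, x₀, hx₀, -⟩ := hM
  obtain ⟨x, hx, hmin⟩ := exists_minimal_decomposition hS ⟨x₀, hx₀⟩
  obtain ⟨w, hw, hwx⟩ := h _ ⟨x, hx, le_rfl⟩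
  have hxT : ∀ y : T →₀ ℂ, IsDecomposition y M →
      (x.sum fun _ c => ‖c‖) ≤ y.sum fun _ c => ‖c‖ := by
    intro y hy
    obtain ⟨z, hz, hzy⟩ := HasBoundedDecomposition.mono_set hTS ⟨y, hy, le_rfl⟩
    exact (hmin z hz).trans hzy
  have hcost : decompositionCost w = decompositionCost x := by
    rw [decompositionCost, decompositionCost, le_antisymm hwx (hxT w hw)]
  have hSl := isLeast_costSet hx hmin
  have hTl := isLeast_costSet hw fun y hy => hwx.trans (hxT y hy)
  rw [hSl.csInf_eq, hTl.csInf_eq]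
  refine ⟨hSl, hTl, hcost.symm, w.embDomain (Set.embeddingOfSubset T S hTS), ?_, ?_, ?_⟩
  · rw [IsDecomposition, Finsupp.sum_embDomain]
    exact hw
  · rw [decompositionCost, Finsupp.sum_embDomain]
    exact hcost
  · intro C hC
    rw [Finsupp.support_embDomain, Finset.mem_map] at hC
    obtain ⟨D, -, rfl⟩ := hC
    exact D.2

/-! ### Invariance under the symmetry groups -/

theorem apply_eq_of_groupProjection_eq {n : ℕ} {G : Subgroup (QMat n ≃ₗ[ℝ] QMat n)} {U : QMat n}
    (hU : U = groupProjection G U) {φ : QMat n ≃ₗ[ℝ] QMat n} (hφ : φ ∈ G) : φ U = U := by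
  rcases finite_or_infinite G with hG | hG
  · have := Fintype.ofFinite G
    conv_lhs => rw [hU]
    conv_rhs => rw [hU]
    rw [groupProjection, finsum_eq_sum_of_fintype, map_smul, map_sum]
    congr 1
    exact Equiv.sum_comp (Equiv.mulLeft (⟨φ, hφ⟩ : G)) fun ψ : G => (ψ : QMat n ≃ₗ[ℝ] QMat n) U
  -- For infinite `G`, `Nat.card` is `0` and the projection degenerates to zero, so the claim
  -- remains true.
  · have : U = 0 := by
      rw [hU, groupProjection, Nat.card_eq_zero_of_infinite, Nat.cast_zero, inv_zero, zero_smul]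
    rw [this, map_zero]

theorem conjMap_apply {n : ℕ} (M : QMat n) : conjMap n M = M.map (starRingEnd ℂ) := rfl

theorem pauliZChannel_apply {n : ℕ} (z : Fin n → ZMod 2) (M : QMat n) :
    pauliZChannel z M = pauliZ z * M * pauliZ z := by
  change pauliZ z * M * (pauliZ z).conjTranspose = _
  rw [pauliZ_conjTranspose]

/-- The subgroup of maps fixing a matrix. -/
noncomputable def fixingMaps {n : ℕ} (M : QMat n) : Subgroup (QMat n ≃ₗ[ℝ] QMat n) :=
  MulAction.stabilizer (QMat n ≃ₗ[ℝ] QMat n) M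

theorem conjugationGroup_le_fixingMaps {n : ℕ} {M : QMat n} (h : M.map (starRingEnd ℂ) = M) :
    conjugationGroup n ≤ fixingMaps M :=
  Subgroup.zpowers_le.2 h

theorem diagonalPauliGroup_le_fixingMaps {n : ℕ} {M : QMat n} (h : ∀ j, Commute (zGate j) M) :
    diagonalPauliGroup n ≤ fixingMaps M := by
  rintro _ ⟨z, rfl⟩
  change pauliZChannel z M = M
  have hc : Commute (weyl 0 z) M := commute_weyl_zero fun j _ => h j
  rw [← pauliZ_eq_weyl] at hc
  rw [pauliZChannel_apply, hc.eq, mul_assoc, pauliZ_mul_self, mul_one]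

theorem cliffords_subset_commutingCliffords_empty {n : ℕ} :
    cliffords n ⊆ commutingCliffords ∅ := by
  intro C hC
  exact ⟨hC, by simp⟩

/-- Each single-qubit average fixes `U`, so the qubits of `J` can be treated one after another at no
cost. -/
theorem HasBoundedDecomposition.diagonal {n : ℕ} {U : QMat n}
    (hU : ∀ φ ∈ diagonalPauliGroup n, φ U = U) {r : ℝ}
    (h : HasBoundedDecomposition (cliffords n) r U) (J : Finset (Fin n)) :
    HasBoundedDecomposition (commutingCliffords J) r U := by
  induction J using Finset.induction_on with
  | empty => exact h.mono_set cliffords_subset_commutingCliffords_empty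
  | insert k J hk ih =>
    have hav : zAverage k U = U := by
      have h1 := hU _ ⟨Pi.single k 1, rfl⟩
      rw [pauliZChannel_apply, pauliZ_eq_weyl] at h1
      rw [zAverage_apply, zGate, h1, ← two_smul ℂ U, smul_smul]
      norm_num
    rw [← hav]
    exact ih.map (zAverage k).toAddMonoidHom fun C hC c => zAverage_commutingCliffords hk hC c

theorem HasBoundedDecomposition.real {n : ℕ} {U : QMat n}
    (hU : ∀ φ ∈ conjugationGroup n, φ U = U) {r : ℝ} {J : Finset (Fin n)}
    (h : HasBoundedDecomposition (commutingCliffords J) r U) :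
    HasBoundedDecomposition {D | D ∈ commutingCliffords J ∧ D.map (starRingEnd ℂ) = D} r U := by
  have hav : realAverage n U = U := by
    have h1 := hU _ (Subgroup.mem_zpowers _)
    rw [conjMap_apply] at h1
    rw [realAverage_apply, h1, ← two_smul ℂ U, smul_smul]
    norm_num
  rw [← hav]
  exact h.map (realAverage n) fun C hC c => realAverage_commutingCliffords hC c

/-- Invariant matrices decompose into invariant Clifford unitaries at no extra cost. -/
theorem HasBoundedDecomposition.invariant {n : ℕ} {G : Subgroup (QMat n ≃ₗ[ℝ] QMat n)}
    (hG : G = conjugationGroup n ∨ G = diagonalPauliGroup n ∨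
      G = conjugationDiagonalPauliGroup n) {U : QMat n} (hU : ∀ φ ∈ G, φ U = U) {r : ℝ}
    (h : HasBoundedDecomposition (cliffords n) r U) :
    HasBoundedDecomposition (invariantCliffords G) r U := by
  rcases hG with rfl | rfl | rfl
  · have h0 : HasBoundedDecomposition (commutingCliffords (∅ : Finset (Fin n))) r U :=
      h.mono_set cliffords_subset_commutingCliffords_empty
    refine (h0.real hU).mono_set ?_
    rintro C ⟨hC, hreal⟩
    exact ⟨hC.1, fun φ hφ => conjugationGroup_le_fixingMaps hreal hφ⟩
  · refine (h.diagonal hU Finset.univ).mono_set ?_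
    rintro C ⟨hC, hcomm⟩
    exact ⟨hC, fun φ hφ =>
      diagonalPauliGroup_le_fixingMaps (fun j => hcomm j (Finset.mem_univ j)) hφ⟩
  · have hK : ∀ φ ∈ conjugationGroup n, φ U = U := fun φ hφ =>
      hU φ (Subgroup.mem_sup_left hφ)
    have hZ : ∀ φ ∈ diagonalPauliGroup n, φ U = U := fun φ hφ =>
      hU φ (Subgroup.mem_sup_right hφ)
    refine ((h.diagonal hZ Finset.univ).real hK).mono_set ?_
    rintro C ⟨⟨hC, hcomm⟩, hreal⟩
    exact ⟨hC, fun φ hφ => sup_le (conjugationGroup_le_fixingMaps hreal)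
      (diagonalPauliGroup_le_fixingMaps fun j => hcomm j (Finset.mem_univ j)) hφ⟩

/-- For `G ∈ {K_n, Z_n, K_n × Z_n}` and every `G`-invariant `U`: both minima exist, they agree, and
an optimal Clifford decomposition of `U` can be chosen with `G`-invariant Cliffords only. -/
theorem theorem1 (n : ℕ) (G : Subgroup (QMat n ≃ₗ[ℝ] QMat n))
    (hG : G = conjugationGroup n ∨ G = diagonalPauliGroup n ∨
      G = conjugationDiagonalPauliGroup n)
    (U : QMat n) (hU : U = groupProjection G U) :
    IsLeast (costSet (cliffords n) U) (stabilizerExtent U) ∧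
      IsLeast (costSet (invariantCliffords G) U) (symmetricExtent G U) ∧
      stabilizerExtent U = symmetricExtent G U ∧
      ∃ x : cliffords n →₀ ℂ, IsDecomposition x U ∧ decompositionCost x = stabilizerExtent U ∧
        ∀ C ∈ x.support, (C : QMat n) ∈ invariantCliffords G := by
  exact isLeast_costSet_of_subset (finite_cliffords n) (fun _ hC => hC.1)
    (exists_hasBoundedDecomposition U) fun _ h =>
      h.invariant hG fun _ hφ => apply_eq_of_groupProjection_eq hU hφ
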